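/- Let $K$ be a field, let $G$ be a simple graph on the vertex set $[n]=\{1,\dots,n\}$ with at least one edge, and let $S=K[x_1,\dots,x_n,y_1,\dots,y_n]$ with the standard grading. Let $$J_G=(x_iy_j-x_jy_i : \{i,j\}\text{ is an edge of }G)\subset S$$ be the binomial edge ideal of $G$, and let $$\operatorname{reg}(J_G)=\max\{j : \beta_{i,i+j}(J_G)\neq 0\text{ for some } i\},\qquad \beta_{i,d}(J_G)=\dim_K \operatorname{Tor}_i^S(J_G,K)_d,$$ be its Castelnuovo–Mumford regularity. Let $\ell$ be the length (number of edges) of a longest induced path of $G$. Then $$\ell+1\leq \operatorname{reg}(J_G)\leq n.$$ -/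

import Mathlib

open MvPolynomial

noncomputable section

/-! ### Binomial edge ideals -/

/-- The index set of the variables `x_1, …, x_n, y_1, …, y_n`, in this order. -/
abbrev EdgeVar (n : ℕ) : Type := Fin n ⊕ₗ Fin n

/-- The variable `x_i` of `S = K[x_1, …, x_n, y_1, …, y_n]`. -/
def xVar (K : Type*) [Field K] {n : ℕ} (i : Fin n) : MvPolynomial (EdgeVar n) K :=
  X (Sum.inlₗ i)

/-- The variable `y_i` of `S = K[x_1, …, x_n, y_1, …, y_n]`. -/
def yVar (K : Type*) [Field K] {n : ℕ} (i : Fin n) : MvPolynomial (EdgeVar n) K :=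
  X (Sum.inrₗ i)

/-- The binomial edge ideal `J_G = (x_i y_j - x_j y_i : {i, j} an edge of G)`. -/
def binomialEdgeIdeal (K : Type*) [Field K] {n : ℕ} (G : SimpleGraph (Fin n)) :
    Ideal (MvPolynomial (EdgeVar n) K) :=
  Ideal.span {f | ∃ i j : Fin n, G.Adj i j ∧ f = xVar K i * yVar K j - xVar K j * yVar K i}

/-! ### Graded Betti numbers

`S = K[X_s : s ∈ σ]` is a polynomial ring in finitely many variables, `M` is an `S`-module with a
grading `ℳ 0, ℳ 1, …` by `K`-subspaces.  The Koszul complex on the variables is the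
(graded) free resolution of `K = S / (X_s : s ∈ σ)`, so `Tor_i(M, K)` is the `i`-th homology
of the Koszul complex with coefficients in `M`. -/

section Koszul

variable {K σ : Type*} [Field K] [Fintype σ] [LinearOrder σ]

/-- The differential of the Koszul complex of the variables with coefficients in `M`.  A function
`c : Finset σ → M` stands for the chain `∑ T, c T • e_T`, where `e_T` has homological degree `#T`,
and the differential is determined by
`e_U ↦ ∑ t ∈ U, (-1) ^ #{u ∈ U | u < t} • X_t • e_{U \ {t}}`. -/
def koszulD (K σ : Type*) [Field K] [Fintype σ] [LinearOrder σ]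
    (M : Type*) [AddCommGroup M] [Module (MvPolynomial σ K) M] :
    (Finset σ → M) →ₗ[MvPolynomial σ K] (Finset σ → M) where
  toFun c T := ∑ t ∈ Tᶜ, ((-1 : MvPolynomial σ K) ^ (T.filter (· < t)).card * X t) • c (insert t T)
  map_add' c c' := by
    funext T
    simp [smul_add, Finset.sum_add_distrib]
  map_smul' a c := by
    funext T
    simp only [Pi.smul_apply, RingHom.id_apply, Finset.smul_sum]
    exact Finset.sum_congr rfl fun t _ => smul_comm _ _ _

/-- The Koszul differential squares to zero. -/
theorem koszulD_koszulD {M : Type*} [AddCommGroup M] [Module (MvPolynomial σ K) M]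
    (c : Finset σ → M) : koszulD K σ M (koszulD K σ M c) = 0 := by
  funext T
  simp only [koszulD, LinearMap.coe_mk, AddHom.coe_mk, Finset.smul_sum, Pi.zero_apply, smul_smul]
  rw [Finset.sum_sigma']
  refine Finset.sum_involution (fun p _ => ⟨p.2, p.1⟩) ?_ ?_ ?_ ?_
  · rintro ⟨t, s⟩ hp
    simp only [Finset.mem_sigma, Finset.mem_compl, Finset.mem_insert, not_or] at hp
    obtain ⟨ht, hst, hs⟩ := hp
    simp only [Finset.insert_comm t s, ← add_smul]
    rw [Finset.filter_insert, Finset.filter_insert]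
    convert zero_smul (MvPolynomial σ K) _
    rcases lt_or_gt_of_ne hst with h | h
    · rw [if_neg h.not_gt, if_pos h, Finset.card_insert_of_notMem (by simp [hs]), pow_succ]
      ring
    · rw [if_pos h, if_neg h.not_gt, Finset.card_insert_of_notMem (by simp [ht]), pow_succ]
      ring
  · rintro ⟨t, s⟩ hp _ h
    simp only [Finset.mem_sigma, Finset.mem_compl, Finset.mem_insert, not_or] at hp
    simp only [Sigma.mk.injEq] at h
    exact hp.2.1 h.1
  · rintro ⟨t, s⟩ hp
    simp only [Finset.mem_sigma, Finset.mem_compl, Finset.mem_insert, not_or] at hp ⊢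
    exact ⟨hp.2.2, fun h => hp.2.1 h.symm, hp.1⟩
  · rintro ⟨t, s⟩ _
    rfl

variable (σ) {M : Type*} [AddCommGroup M] [Module (MvPolynomial σ K) M]
  [Module K M] [IsScalarTower K (MvPolynomial σ K) M]

/-- The chains of homological degree `i` and internal degree `d`: since `e_T` has degree `#T`, these
are the `∑ T, c T • e_T` with `#T = i` and coefficients of degree `d - i` (zero if `d < i`). -/
def koszulChains (ℳ : ℕ → Submodule K M) (i d : ℕ) : Submodule K (Finset σ → M) :=
  Submodule.pi Set.univ fun T => if T.card = i ∧ i ≤ d then ℳ (d - i) else ⊥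

/-- The cycles of homological degree `i` and internal degree `d`. -/
def koszulCycles (ℳ : ℕ → Submodule K M) (i d : ℕ) : Submodule K (Finset σ → M) :=
  koszulChains σ ℳ i d ⊓ (LinearMap.ker (koszulD K σ M)).restrictScalars K

/-- The boundaries of homological degree `i` and internal degree `d`: the images of the
chains of homological degree `i + 1` and internal degree `d`. -/
def koszulBoundaries (ℳ : ℕ → Submodule K M) (i d : ℕ) : Submodule K (Finset σ → M) :=
  (koszulChains σ ℳ (i + 1) d).map ((koszulD K σ M).restrictScalars K)

/-- `Tor_i(M, K)_d`: cycles modulo boundaries in homological degree `i` and internal degree `d`. -/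
abbrev GradedTor (ℳ : ℕ → Submodule K M) (i d : ℕ) : Type _ :=
  koszulCycles σ ℳ i d ⧸ (koszulBoundaries σ ℳ i d).submoduleOf (koszulCycles σ ℳ i d)

/-- The graded Betti number `β_{i,d}(M) = dim_K Tor_i(M, K)_d`. -/
def gradedBetti (ℳ : ℕ → Submodule K M) (i d : ℕ) : Cardinal :=
  Module.rank K (GradedTor σ ℳ i d)

/-- `r` is the Castelnuovo–Mumford regularity of `M`, that is,
`r = max {j : β_{i,i+j}(M) ≠ 0 for some i}`. -/
def IsRegularity (ℳ : ℕ → Submodule K M) (r : ℕ) : Prop :=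
  IsGreatest {j : ℕ | ∃ i : ℕ, gradedBetti σ ℳ i (i + j) ≠ 0} r

end Koszul

/-- The standard grading of an ideal `I` of `S`, regarded as an `S`-module: the degree `d` part
consists of the homogeneous polynomials of degree `d` in `I`. -/
def idealGrading {K σ : Type*} [Field K] (I : Ideal (MvPolynomial σ K)) (d : ℕ) : Submodule K I :=
  (homogeneousSubmodule σ K d).comap (I.subtype.restrictScalars K)

end

/-! Since `S` has regularity 0, reg `J_G` = reg `S/J_G` + 1, so the claim is ℓ ≤ reg `S/J_G` ≤ n -
1. Regularity is read off from vanishing of Koszul homology of subquotients `I/L` of `S`.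

Path forests are the computable case. Adding a vertex `v` at the end of a path brings two fresh
variables, so its edge binomial is regular modulo the previous ones. Each edge raises the regularity
by at most one (`regLT_listGraph`), and a path with m edges has `Tor_m` nonzero in degree 2m
(`not_koszulVanishes_path`).

Upper bound: let `G_v` arise from `G` by making the neighbours of `v` a clique. Then `J_G` is the
intersection of `J_{G_v}` and `J_{G-v} + (x_v, y_v)`, so `J_{G_v}/J_G` is governed by graphs on one
vertex fewer (`regLT_completeNeighborhood_iff`). By induction, the bound |V| - 1 holds for `G` iff
it holds for `G_v`, hence iff it holds for the union of cliques on the components of `G`. A path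
forest with the same components has the same closure and satisfies the bound, so every `G` does
(`regLT_card`); cliques are never computed directly.

Lower bound: for an induced path `P`, adding the variables of the remaining vertices gives `S/J_P →
S/J_G → S/(J_P + variables)`. The composite is injective on Tor, hence so is the first map
(`KoszulVanishes.of_induced`). -/

set_option linter.unusedSectionVars false

noncomputable section

/-! ### Koszul homology of subquotients of the polynomial ring -/

section KoszulVanishing

variable {K σ : Type*} [Field K] [Fintype σ] [LinearOrder σ]

/-- The chains of the Koszul complex of `S` which take values in an ideal `L`. -/
def chainsIn (L : Ideal (MvPolynomial σ K)) :
    Submodule (MvPolynomial σ K) (Finset σ → MvPolynomial σ K) :=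
  Submodule.pi Set.univ fun _ => L

theorem mem_chainsIn {L : Ideal (MvPolynomial σ K)} {c : Finset σ → MvPolynomial σ K} :
    c ∈ chainsIn L ↔ ∀ T, c T ∈ L := by
  simp [chainsIn]

theorem chainsIn_mono {I L : Ideal (MvPolynomial σ K)} (h : L ≤ I) : chainsIn L ≤ chainsIn I :=
  fun _ hc => mem_chainsIn.2 fun T => h (mem_chainsIn.1 hc T)

theorem koszulD_apply (c : Finset σ → MvPolynomial σ K) (T : Finset σ) :
    koszulD K σ (MvPolynomial σ K) c T =
      ∑ t ∈ Tᶜ, ((-1 : MvPolynomial σ K) ^ (T.filter (· < t)).card * X t) * c (insert t T) :=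
  rfl

theorem koszulD_mem_chainsIn {L : Ideal (MvPolynomial σ K)} {c : Finset σ → MvPolynomial σ K}
    (hc : c ∈ chainsIn L) : koszulD K σ (MvPolynomial σ K) c ∈ chainsIn L :=
  mem_chainsIn.2 fun T => by
    rw [koszulD_apply]
    exact Ideal.sum_mem _ fun t _ => L.mul_mem_left _ (mem_chainsIn.1 hc _)

/-- The chains of homological degree `i` whose coefficients are forms of degree `j` in `I`. -/
def idealChains (I : Ideal (MvPolynomial σ K)) (i j : ℕ) :
    Submodule K (Finset σ → MvPolynomial σ K) where
  carrier := {c | ∀ T, c T ∈ I ∧ (c T).IsHomogeneous j ∧ (T.card ≠ i → c T = 0)}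
  add_mem' h h' T := ⟨I.add_mem (h T).1 (h' T).1, (h T).2.1.add (h' T).2.1, fun hT => by
    simp [(h T).2.2 hT, (h' T).2.2 hT]⟩
  zero_mem' T := ⟨I.zero_mem, isHomogeneous_zero _ _ _, fun _ => rfl⟩
  smul_mem' a c h T := ⟨by
      rw [Pi.smul_apply, MvPolynomial.smul_eq_C_mul]; exact I.mul_mem_left _ (h T).1,
    (homogeneousSubmodule σ K j).smul_mem a (h T).2.1, fun hT => by simp [(h T).2.2 hT]⟩

theorem mem_idealChains {I : Ideal (MvPolynomial σ K)} {i j : ℕ}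
    {c : Finset σ → MvPolynomial σ K} : c ∈ idealChains I i j ↔
      ∀ T, c T ∈ I ∧ (c T).IsHomogeneous j ∧ (T.card ≠ i → c T = 0) := Iff.rfl

theorem idealChains_mono {I L : Ideal (MvPolynomial σ K)} (h : L ≤ I) (i j : ℕ) :
    idealChains L i j ≤ idealChains I i j :=
  fun _ hc T => ⟨h (hc T).1, (hc T).2⟩

theorem idealChains_of_mem {I L : Ideal (MvPolynomial σ K)} {i j : ℕ}
    {c : Finset σ → MvPolynomial σ K} (hc : c ∈ idealChains I i j) (h : c ∈ chainsIn L) :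
    c ∈ idealChains L i j :=
  fun T => ⟨mem_chainsIn.1 h T, (hc T).2⟩

theorem mem_chainsIn_of_idealChains {I : Ideal (MvPolynomial σ K)} {i j : ℕ}
    {c : Finset σ → MvPolynomial σ K} (hc : c ∈ idealChains I i j) : c ∈ chainsIn I :=
  mem_chainsIn.2 fun T => (hc T).1

theorem isHomogeneous_sign_mul (k : ℕ) {p : MvPolynomial σ K} {j : ℕ} (hp : p.IsHomogeneous j) :
    ((-1 : MvPolynomial σ K) ^ k * p).IsHomogeneous j := by
  rcases neg_one_pow_eq_or (MvPolynomial σ K) k with h | h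
  · simpa [h] using hp
  · simpa [h] using hp.neg

theorem koszulD_mem_idealChains {I : Ideal (MvPolynomial σ K)} {i j : ℕ}
    {c : Finset σ → MvPolynomial σ K} (hc : c ∈ idealChains I (i + 1) j) :
    koszulD K σ (MvPolynomial σ K) c ∈ idealChains I i (j + 1) := fun T => by
  rw [koszulD_apply]
  refine ⟨Ideal.sum_mem _ fun t _ => I.mul_mem_left _ (hc _).1, ?_, fun hT => ?_⟩
  · refine IsHomogeneous.sum _ _ _ fun t _ => ?_
    rw [mul_assoc, add_comm]
    exact isHomogeneous_sign_mul _ ((isHomogeneous_X K t).mul (hc _).2.1)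
  · refine Finset.sum_eq_zero fun t ht => ?_
    rw [(hc _).2.2, mul_zero]
    rw [Finset.card_insert_of_notMem (Finset.mem_compl.1 ht)]
    omega

theorem koszulD_eq_zero_of_idealChains_zero {I : Ideal (MvPolynomial σ K)} {j : ℕ}
    {c : Finset σ → MvPolynomial σ K} (hc : c ∈ idealChains I 0 j) :
    koszulD K σ (MvPolynomial σ K) c = 0 := by
  funext T
  rw [koszulD_apply]
  refine Finset.sum_eq_zero fun t _ => ?_
  rw [(hc _).2.2, mul_zero]
  exact Finset.card_ne_zero_of_mem (Finset.mem_insert_self t T)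

/-- The boundaries in homological degree `i` with coefficients of degree `j` of chains with
values in `I`. -/
def idealBoundaries (I : Ideal (MvPolynomial σ K)) (i : ℕ) :
    ℕ → Submodule K (Finset σ → MvPolynomial σ K)
  | 0 => ⊥
  | j + 1 => (idealChains I (i + 1) j).map
      ((koszulD K σ (MvPolynomial σ K)).restrictScalars K)

theorem mem_idealBoundaries_succ {I : Ideal (MvPolynomial σ K)} {i j : ℕ}
    {c : Finset σ → MvPolynomial σ K} : c ∈ idealBoundaries I i (j + 1) ↔
      ∃ b ∈ idealChains I (i + 1) j, koszulD K σ (MvPolynomial σ K) b = c := Iff.rfl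

theorem idealBoundaries_le (I : Ideal (MvPolynomial σ K)) (i j : ℕ) :
    idealBoundaries I i j ≤ idealChains I i j := by
  cases j with
  | zero => exact bot_le
  | succ j =>
    rintro _ ⟨b, hb, rfl⟩
    exact koszulD_mem_idealChains hb

theorem idealBoundaries_mono {I L : Ideal (MvPolynomial σ K)} (h : L ≤ I) (i j : ℕ) :
    idealBoundaries L i j ≤ idealBoundaries I i j := by
  cases j with
  | zero => exact bot_le
  | succ j => exact Submodule.map_mono (idealChains_mono h _ _)

theorem koszulD_idealBoundaries {I : Ideal (MvPolynomial σ K)} {i j : ℕ}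
    {c : Finset σ → MvPolynomial σ K} (hc : c ∈ idealBoundaries I i j) :
    koszulD K σ (MvPolynomial σ K) c = 0 := by
  cases j with
  | zero => rw [(Submodule.mem_bot K).1 hc, map_zero]
  | succ j =>
    obtain ⟨b, -, rfl⟩ := hc
    exact koszulD_koszulD b

/-- The Koszul homology of `I / L` vanishes in homological degree `i` and coefficient degree `j`,
that is, `Tor_i(I / L, K)_{i + j} = 0`. -/
def KoszulVanishes (I L : Ideal (MvPolynomial σ K)) (i j : ℕ) : Prop :=
  ∀ c ∈ idealChains I i j, koszulD K σ (MvPolynomial σ K) c ∈ chainsIn L →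
    ∃ b ∈ idealBoundaries I i j, c - b ∈ chainsIn L

section ShortExact

variable {I J L : Ideal (MvPolynomial σ K)} {i j : ℕ}

/-- This and the next two lemmas are exactness of the long Tor sequence of `0 → J/L → I/L → I/J → 0`
at its three terms. The connecting map lowers `i` and raises the coefficient degree `j` by one. -/
theorem KoszulVanishes.middle (hLJ : L ≤ J) (hJI : J ≤ I) (h₁ : KoszulVanishes J L i j)
    (h₂ : KoszulVanishes I J i j) : KoszulVanishes I L i j := by
  intro c hc hDc
  obtain ⟨b, hb, hcb⟩ := h₂ c hc (chainsIn_mono hLJ hDc)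
  obtain ⟨b', hb', hcb'⟩ := h₁ (c - b)
    (idealChains_of_mem (Submodule.sub_mem _ hc (idealBoundaries_le _ _ _ hb)) hcb)
    (by rwa [map_sub, koszulD_idealBoundaries hb, sub_zero])
  exact ⟨b + b', Submodule.add_mem _ hb (idealBoundaries_mono hJI _ _ hb'), by
    rwa [← sub_sub]⟩

theorem KoszulVanishes.left (hLJ : L ≤ J) (hJI : J ≤ I) (h₁ : KoszulVanishes I L i (j + 1))
    (h₂ : KoszulVanishes I J (i + 1) j) : KoszulVanishes J L i (j + 1) := by
  intro c hc hDc
  obtain ⟨_, ⟨b, hb, rfl⟩, hcb⟩ := h₁ c (idealChains_mono hJI _ _ hc) hDc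
  simp only [LinearMap.coe_restrictScalars] at hcb
  obtain ⟨b', hb', hbb'⟩ := h₂ b hb (by
    have := Submodule.sub_mem _ (mem_chainsIn_of_idealChains hc) (chainsIn_mono hLJ hcb)
    rwa [sub_sub_cancel] at this)
  refine ⟨_, mem_idealBoundaries_succ.2 ⟨b - b', idealChains_of_mem
    (Submodule.sub_mem _ hb (idealBoundaries_le _ _ _ hb')) hbb', rfl⟩, ?_⟩
  rwa [map_sub, koszulD_idealBoundaries hb', sub_zero]

theorem KoszulVanishes.right (hLJ : L ≤ J) (hJI : J ≤ I) (h₁ : KoszulVanishes I L (i + 1) j)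
    (h₂ : KoszulVanishes J L i (j + 1)) : KoszulVanishes I J (i + 1) j := by
  intro c hc hDc
  obtain ⟨_, ⟨b, hb, rfl⟩, hcb⟩ := h₂ _ (idealChains_of_mem (koszulD_mem_idealChains hc) hDc)
    (by rw [koszulD_koszulD]; exact Submodule.zero_mem _)
  simp only [LinearMap.coe_restrictScalars, ← map_sub] at hcb
  obtain ⟨b', hb', hcb'⟩ := h₁ _ (Submodule.sub_mem _ hc (idealChains_mono hJI _ _ hb)) hcb
  refine ⟨b', hb', ?_⟩
  have := Submodule.add_mem _ (chainsIn_mono hLJ hcb') (mem_chainsIn_of_idealChains hb)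
  convert this using 1
  abel

theorem KoszulVanishes.right_zero (h₁ : KoszulVanishes I L 0 j) (hLJ : L ≤ J) :
    KoszulVanishes I J 0 j := by
  intro c hc _
  obtain ⟨b, hb, hcb⟩ := h₁ c hc (by
    rw [koszulD_eq_zero_of_idealChains_zero hc]; exact Submodule.zero_mem _)
  exact ⟨b, hb, chainsIn_mono hLJ hcb⟩

end ShortExact

/-- Exterior multiplication by the basis element `e_t` on the Koszul complex. -/
def koszulWedge (t : σ) : (Finset σ → MvPolynomial σ K) →ₗ[MvPolynomial σ K]
    (Finset σ → MvPolynomial σ K) where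
  toFun c T := if t ∈ T then (-1) ^ (T.filter (· < t)).card * c (T.erase t) else 0
  map_add' c c' := by
    funext T
    by_cases h : t ∈ T <;> simp [h, mul_add]
  map_smul' a c := by
    funext T
    by_cases h : t ∈ T <;> simp [h, mul_left_comm]

theorem koszulWedge_apply (t : σ) (c : Finset σ → MvPolynomial σ K) (T : Finset σ) :
    koszulWedge t c T =
      if t ∈ T then (-1) ^ (T.filter (· < t)).card * c (T.erase t) else 0 := rfl

/-- Multiplication by a variable is null-homotopic on the Koszul complex. -/
theorem koszulD_koszulWedge (t : σ) (c : Finset σ → MvPolynomial σ K) :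
    koszulD K σ (MvPolynomial σ K) (koszulWedge t c) +
      koszulWedge t (koszulD K σ (MvPolynomial σ K) c) = (X t : MvPolynomial σ K) • c := by
  funext T
  rw [Pi.add_apply, koszulWedge_apply, koszulD_apply, Pi.smul_apply, smul_eq_mul]
  by_cases ht : t ∈ T
  · rw [if_pos ht, koszulD_apply, Finset.compl_erase, Finset.sum_insert (by simpa using ht),
      mul_add, Finset.insert_erase ht, add_left_comm]
    have hsq : (-1 : MvPolynomial σ K) ^ (T.filter (· < t)).card *
        ((-1 : MvPolynomial σ K) ^ ((T.erase t).filter (· < t)).card * X t * c T) =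
        X t * c T := by
      have : (T.erase t).filter (· < t) = T.filter (· < t) := by
        ext s; simp only [Finset.mem_filter, Finset.mem_erase]
        exact ⟨fun h => ⟨h.1.2, h.2⟩, fun h => ⟨⟨h.2.ne, h.1⟩, h.2⟩⟩
      rw [this, ← mul_assoc, ← mul_assoc, ← mul_pow]
      simp
    rw [hsq, Finset.mul_sum, ← Finset.sum_add_distrib, Finset.sum_eq_zero, add_zero]
    intro s hs
    have hs := Finset.mem_compl.1 hs
    have hst : s ≠ t := fun h => hs (h ▸ ht)
    rw [koszulWedge_apply, if_pos (Finset.mem_insert_of_mem ht),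
      Finset.erase_insert_of_ne hst, Finset.filter_insert]
    -- Inserting `s` and erasing `t` in the two possible orders changes exactly one of the two
    -- signs, so the terms cancel.
    rcases lt_or_gt_of_ne hst with h | h
    · have h1 : (T.erase t).filter (· < s) = T.filter (· < s) := by
        ext u; simp only [Finset.mem_filter, Finset.mem_erase]
        exact ⟨fun h => ⟨h.1.2, h.2⟩, fun h' => ⟨⟨(h'.2.trans h).ne, h'.1⟩, h'.2⟩⟩
      rw [if_pos h, Finset.card_insert_of_notMem (by simp [hs]), h1, pow_succ]
      ring
    · have h1 : (T.filter (· < s)) = insert t ((T.erase t).filter (· < s)) := by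
        ext u; simp only [Finset.mem_filter, Finset.mem_erase, Finset.mem_insert]
        by_cases hu : u = t <;> simp [hu, h, ht]
      rw [if_neg h.not_gt, h1, Finset.card_insert_of_notMem (by simp), pow_succ]
      ring
  · rw [if_neg ht, add_zero, Finset.sum_eq_single t]
    · rw [koszulWedge_apply, if_pos (Finset.mem_insert_self _ _), Finset.erase_insert ht,
        Finset.filter_insert, if_neg (lt_irrefl t)]
      rw [mul_comm _ (X t), mul_assoc, ← mul_assoc (_ ^ _), ← mul_pow]
      simp
    · intro s _ hs
      rw [koszulWedge_apply, if_neg, mul_zero]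
      simp [ht, hs.symm]
    · intro h
      exact absurd (Finset.mem_compl.2 ht) h

theorem koszulWedge_mem_chainsIn {L : Ideal (MvPolynomial σ K)} (t : σ)
    {c : Finset σ → MvPolynomial σ K} (hc : c ∈ chainsIn L) : koszulWedge t c ∈ chainsIn L :=
  mem_chainsIn.2 fun T => by
    rw [koszulWedge_apply]
    split_ifs
    · exact L.mul_mem_left _ (mem_chainsIn.1 hc _)
    · exact L.zero_mem

theorem koszulWedge_mem_idealChains {I : Ideal (MvPolynomial σ K)} (t : σ) {i j : ℕ}
    {c : Finset σ → MvPolynomial σ K} (hc : c ∈ idealChains I i j) :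
    koszulWedge t c ∈ idealChains I (i + 1) j := fun T => by
  rw [koszulWedge_apply]
  split_ifs with ht
  · refine ⟨I.mul_mem_left _ (hc _).1, isHomogeneous_sign_mul _ (hc _).2.1, fun hT => ?_⟩
    rw [(hc _).2.2, mul_zero]
    have := Finset.card_erase_add_one ht
    omega
  · exact ⟨I.zero_mem, isHomogeneous_zero _ _ _, fun _ => rfl⟩

theorem smul_mem_idealChains {I : Ideal (MvPolynomial σ K)} {i j e : ℕ} {f : MvPolynomial σ K}
    (hf : f.IsHomogeneous e) {c : Finset σ → MvPolynomial σ K} (hc : c ∈ idealChains I i j) :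
    f • c ∈ idealChains I i (j + e) := fun T =>
  ⟨I.mul_mem_left _ (hc T).1, by rw [add_comm]; exact hf.mul (hc T).2.1, fun hT => by
    simp [(hc T).2.2 hT]⟩

theorem smul_mem_idealBoundaries {I L : Ideal (MvPolynomial σ K)} {i j e : ℕ}
    {f : MvPolynomial σ K} (hf : f.IsHomogeneous e) (hfL : f ∈ L)
    {c : Finset σ → MvPolynomial σ K} (hc : c ∈ idealBoundaries I i j) :
    f • c ∈ idealBoundaries L i (j + e) := by
  cases j with
  | zero => rw [(Submodule.mem_bot K).1 hc, smul_zero]; exact Submodule.zero_mem _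
  | succ j =>
    obtain ⟨b, hb, rfl⟩ := hc
    rw [add_right_comm]
    refine mem_idealBoundaries_succ.2 ⟨f • b, idealChains_of_mem (smul_mem_idealChains hf hb)
      (mem_chainsIn.2 fun T => L.mul_mem_right _ hfL), ?_⟩
    rw [map_smul]; rfl

end KoszulVanishing

/-! ### Graded ideals and homogeneous division -/

section GradedIdeal

variable {K σ : Type*} [Field K]

/-- An ideal of `S` which contains the homogeneous components of its elements. -/
def IsGradedIdeal (I : Ideal (MvPolynomial σ K)) : Prop :=
  ∀ p ∈ I, ∀ j, homogeneousComponent j p ∈ I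

attribute [local instance] MvPolynomial.gradedAlgebra in
theorem isGradedIdeal_span {s : Set (MvPolynomial σ K)} (h : ∀ p ∈ s, ∃ e, p.IsHomogeneous e) :
    IsGradedIdeal (Ideal.span s) := fun _ hp j =>
  homogeneousComponent_mem_of_mem (Ideal.homogeneous_span (homogeneousSubmodule σ K) s h) hp j

theorem IsGradedIdeal.sup {I J : Ideal (MvPolynomial σ K)} (hI : IsGradedIdeal I)
    (hJ : IsGradedIdeal J) : IsGradedIdeal (I ⊔ J) := fun p hp j => by
  obtain ⟨a, ha, b, hb, rfl⟩ := Submodule.mem_sup.1 hp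
  rw [map_add]
  exact Submodule.add_mem_sup (hI a ha j) (hJ b hb j)

theorem IsGradedIdeal.exists_add {I J : Ideal (MvPolynomial σ K)} (hI : IsGradedIdeal I)
    (hJ : IsGradedIdeal J) {p : MvPolynomial σ K} (hp : p ∈ I ⊔ J) {j : ℕ}
    (hj : p.IsHomogeneous j) :
    ∃ a ∈ I, ∃ b ∈ J, a.IsHomogeneous j ∧ b.IsHomogeneous j ∧ p = a + b := by
  obtain ⟨a, ha, b, hb, rfl⟩ := Submodule.mem_sup.1 hp
  refine ⟨_, hI a ha j, _, hJ b hb j, homogeneousComponent_isHomogeneous _ _,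
    homogeneousComponent_isHomogeneous _ _, ?_⟩
  rw [← map_add, homogeneousComponent_eq_self hj]

theorem homogeneousComponent_mul_of_isHomogeneous {f : MvPolynomial σ K} {e : ℕ}
    (hf : f.IsHomogeneous e) (g : MvPolynomial σ K) (j : ℕ) :
    homogeneousComponent (j + e) (f * g) = f * homogeneousComponent j g := by
  conv_lhs => rw [← sum_homogeneousComponent g]
  rw [Finset.mul_sum, map_sum]
  have key : ∀ k, homogeneousComponent (j + e) (f * homogeneousComponent k g) =
      if k = j then f * homogeneousComponent k g else 0 := fun k => by
    rw [homogeneousComponent_of_mem (m := j + e) (n := e + k)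
      (hf.mul (homogeneousComponent_isHomogeneous k g))]
    by_cases h : k = j
    · rw [if_pos (by omega), if_pos h]
    · rw [if_neg (by omega), if_neg h]
  simp only [key]
  rw [Finset.sum_ite_eq']
  split_ifs with h
  · rfl
  · rw [homogeneousComponent_eq_zero, mul_zero]
    simpa using h

theorem homogeneousComponent_mul_of_lt {f : MvPolynomial σ K} {e : ℕ}
    (hf : f.IsHomogeneous e) (g : MvPolynomial σ K) {j : ℕ} (hj : j < e) :
    homogeneousComponent j (f * g) = 0 := by
  conv_lhs => rw [← sum_homogeneousComponent g]
  rw [Finset.mul_sum, map_sum]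
  refine Finset.sum_eq_zero fun k _ => ?_
  rw [homogeneousComponent_of_mem (m := j) (n := e + k)
      (hf.mul (homogeneousComponent_isHomogeneous k g)), if_neg (by omega)]

theorem IsGradedIdeal.exists_add_mul {Q : Ideal (MvPolynomial σ K)} (hQ : IsGradedIdeal Q)
    {f p : MvPolynomial σ K} {e j : ℕ} (hf : f.IsHomogeneous e) (hp : p ∈ Q ⊔ Ideal.span {f})
    (hj : p.IsHomogeneous (j + e)) : ∃ g, g.IsHomogeneous j ∧ p - f * g ∈ Q := by
  obtain ⟨a, ha, b, hb, rfl⟩ := Submodule.mem_sup.1 hp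
  obtain ⟨g, rfl⟩ := Ideal.mem_span_singleton'.1 hb
  refine ⟨_, homogeneousComponent_isHomogeneous j g, ?_⟩
  rw [← homogeneousComponent_mul_of_isHomogeneous hf, ← homogeneousComponent_eq_self hj, mul_comm f,
    ← map_sub, add_sub_cancel_right]
  exact hQ a ha _

theorem IsGradedIdeal.mem_of_lt {Q : Ideal (MvPolynomial σ K)} (hQ : IsGradedIdeal Q)
    {f p : MvPolynomial σ K} {e j : ℕ} (hf : f.IsHomogeneous e) (hp : p ∈ Q ⊔ Ideal.span {f})
    (hj : p.IsHomogeneous j) (hje : j < e) : p ∈ Q := by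
  obtain ⟨a, ha, b, hb, rfl⟩ := Submodule.mem_sup.1 hp
  obtain ⟨g, rfl⟩ := Ideal.mem_span_singleton'.1 hb
  rw [← homogeneousComponent_eq_self hj, map_add, mul_comm, homogeneousComponent_mul_of_lt hf _ hje,
    add_zero]
  exact hQ a ha _

end GradedIdeal

/-! ### Regularity modulo a regular element -/

section RegularityBounds

variable {K σ : Type*} [Field K] [Fintype σ] [LinearOrder σ]

/-- Multiplication by `f` is injective on `S / Q`. -/
def IsRegularMod (Q : Ideal (MvPolynomial σ K)) (f : MvPolynomial σ K) : Prop :=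
  ∀ p, f * p ∈ Q → p ∈ Q

/-- The regularity of `I / L` is less than `r`. -/
def RegLT (I L : Ideal (MvPolynomial σ K)) (r : ℕ) : Prop :=
  ∀ i j, r ≤ j → KoszulVanishes I L i j

theorem RegLT.mono {I L : Ideal (MvPolynomial σ K)} {r s : ℕ} (h : RegLT I L r) (hrs : r ≤ s) :
    RegLT I L s := fun i j hj => h i j (hrs.trans hj)

theorem exists_idealChains_add {I B : Ideal (MvPolynomial σ K)} (hI : IsGradedIdeal I)
    (hB : IsGradedIdeal B) {i j : ℕ} {c : Finset σ → MvPolynomial σ K}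
    (hc : c ∈ idealChains (I ⊔ B) i j) :
    ∃ a ∈ idealChains I i j, ∃ b ∈ idealChains B i j, c = a + b := by
  have H : ∀ T, ∃ a b, (a ∈ I ∧ a.IsHomogeneous j ∧ (T.card ≠ i → a = 0)) ∧
      (b ∈ B ∧ b.IsHomogeneous j ∧ (T.card ≠ i → b = 0)) ∧ c T = a + b := by
    intro T
    by_cases hT : T.card = i
    · obtain ⟨a, ha, b, hb, ha', hb', h⟩ := hI.exists_add hB (hc T).1 (hc T).2.1
      exact ⟨a, b, ⟨ha, ha', fun h => absurd hT h⟩, ⟨hb, hb', fun h => absurd hT h⟩, h⟩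
    · exact ⟨0, 0, ⟨I.zero_mem, isHomogeneous_zero _ _ _, fun _ => rfl⟩,
        ⟨B.zero_mem, isHomogeneous_zero _ _ _, fun _ => rfl⟩, by simp [(hc T).2.2 hT]⟩
  choose a b ha hb h using H
  exact ⟨a, ha, b, hb, funext h⟩

theorem exists_idealChains_sub_smul {Q : Ideal (MvPolynomial σ K)} (hQ : IsGradedIdeal Q)
    {f : MvPolynomial σ K} {e : ℕ} (hf : f.IsHomogeneous e) {I : Ideal (MvPolynomial σ K)}
    {i j : ℕ} {c : Finset σ → MvPolynomial σ K} (hc : c ∈ idealChains I i (j + e))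
    (hcf : c ∈ chainsIn (Q ⊔ Ideal.span {f})) :
    ∃ g ∈ idealChains ⊤ i j, c - f • g ∈ chainsIn Q := by
  have H : ∀ T, ∃ g : MvPolynomial σ K, (g ∈ (⊤ : Ideal (MvPolynomial σ K)) ∧ g.IsHomogeneous j ∧
      (T.card ≠ i → g = 0)) ∧ c T - f * g ∈ Q := by
    intro T
    by_cases hT : T.card = i
    · obtain ⟨g, hg, h⟩ := hQ.exists_add_mul hf (mem_chainsIn.1 hcf T) (hc T).2.1
      exact ⟨g, ⟨trivial, hg, fun h => absurd hT h⟩, h⟩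
    · exact ⟨0, ⟨trivial, isHomogeneous_zero _ _ _, fun _ => rfl⟩, by simp [(hc T).2.2 hT]⟩
  choose g hg h using H
  exact ⟨g, hg, mem_chainsIn.2 h⟩

theorem chainsIn_of_lt {Q : Ideal (MvPolynomial σ K)} (hQ : IsGradedIdeal Q)
    {f : MvPolynomial σ K} {e : ℕ} (hf : f.IsHomogeneous e) {I : Ideal (MvPolynomial σ K)}
    {i j : ℕ} {c : Finset σ → MvPolynomial σ K} (hc : c ∈ idealChains I i j)
    (hcf : c ∈ chainsIn (Q ⊔ Ideal.span {f})) (hj : j < e) : c ∈ chainsIn Q :=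
  mem_chainsIn.2 fun T => hQ.mem_of_lt hf (mem_chainsIn.1 hcf T) (hc T).2.1 hj

theorem IsRegularMod.chainsIn {Q : Ideal (MvPolynomial σ K)} {f : MvPolynomial σ K}
    (h : IsRegularMod Q f) {c : Finset σ → MvPolynomial σ K} (hc : f • c ∈ chainsIn Q) :
    c ∈ chainsIn Q :=
  mem_chainsIn.2 fun T => h _ (mem_chainsIn.1 hc T)

/-- Vanishing passes along the isomorphism `I / (I ∩ B) ≅ (I + B) / B`. -/
theorem KoszulVanishes.of_sup {I B : Ideal (MvPolynomial σ K)} (hI : IsGradedIdeal I)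
    (hB : IsGradedIdeal B) {i j : ℕ} (h : KoszulVanishes (I ⊔ B) B i j) :
    KoszulVanishes I (I ⊓ B) i j := by
  intro c hc hDc
  obtain ⟨b, hb, hcb⟩ := h c (idealChains_mono le_sup_left _ _ hc) (chainsIn_mono inf_le_right hDc)
  have key : ∃ b' ∈ idealBoundaries I i j, c - b' ∈ chainsIn B := by
    cases j with
    | zero => exact ⟨b, hb, hcb⟩
    | succ j =>
      obtain ⟨b₀, hb₀, rfl⟩ := hb
      obtain ⟨b₁, hb₁, b₂, hb₂, rfl⟩ := exists_idealChains_add hI hB hb₀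
      refine ⟨_, mem_idealBoundaries_succ.2 ⟨b₁, hb₁, rfl⟩, ?_⟩
      simp only [LinearMap.coe_restrictScalars, map_add] at hcb
      have := Submodule.add_mem _ hcb (koszulD_mem_chainsIn (mem_chainsIn_of_idealChains hb₂))
      convert this using 1
      abel
  obtain ⟨b', hb', hcb'⟩ := key
  refine ⟨b', hb', mem_chainsIn.2 fun T => ⟨?_, mem_chainsIn.1 hcb' T⟩⟩
  exact I.sub_mem (hc T).1 (idealBoundaries_le _ _ _ hb' T).1

/-- Multiplication by `f` identifies `S/Q`, shifted by `e`, with `(Q + (f))/Q`. -/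
theorem KoszulVanishes.of_isRegularMod {Q : Ideal (MvPolynomial σ K)} (hQ : IsGradedIdeal Q)
    {f : MvPolynomial σ K} {e : ℕ} (hf : f.IsHomogeneous e) (hreg : IsRegularMod Q f) {i j : ℕ}
    (h : KoszulVanishes ⊤ Q i j) : KoszulVanishes (Q ⊔ Ideal.span {f}) Q i (j + e) := by
  intro c hc hDc
  obtain ⟨g, hg, hcg⟩ := exists_idealChains_sub_smul hQ hf hc (mem_chainsIn_of_idealChains hc)
  obtain ⟨b, hb, hgb⟩ := h g hg (hreg.chainsIn (by
    have := Submodule.sub_mem _ hDc (koszulD_mem_chainsIn hcg)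
    rwa [map_sub, sub_sub_cancel, map_smul] at this))
  refine ⟨f • b, smul_mem_idealBoundaries hf
    (Ideal.mem_sup_right (Ideal.mem_span_singleton_self f)) hb, ?_⟩
  have := Submodule.add_mem _ hcg (Submodule.smul_mem _ f hgb)
  convert this using 1
  rw [smul_sub]
  abel

/-- In `0 → (Q + (f))/Q → S/Q → S/(Q + (f)) → 0` the left term costs `e + 1` degrees, and the
connecting map gives one back. -/
theorem RegLT.sup_span {Q : Ideal (MvPolynomial σ K)} (hQ : IsGradedIdeal Q)
    {f : MvPolynomial σ K} {e : ℕ} (hf : f.IsHomogeneous (e + 1)) (hreg : IsRegularMod Q f) {r : ℕ}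
    (h : RegLT ⊤ Q r) : RegLT ⊤ (Q ⊔ Ideal.span {f}) (r + e) := by
  have hsub : RegLT (Q ⊔ Ideal.span {f}) Q (r + (e + 1)) := by
    intro i j hj
    obtain ⟨k, rfl⟩ := Nat.exists_eq_add_of_le' (show e + 1 ≤ j by omega)
    exact (h i k (by omega)).of_isRegularMod hQ hf hreg
  intro i j hj
  cases i with
  | zero => exact (h 0 j (by omega)).right_zero le_sup_left
  | succ i => exact (h (i + 1) j (by omega)).right le_sup_left le_top (hsub i (j + 1) (by omega))

/-- For a variable `X t` which is regular on `S / Q`, the map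
`Tor(S / Q, K) → Tor(S / (Q + (X t)), K)` is injective. -/
theorem exists_boundary_of_isRegularMod_X {Q : Ideal (MvPolynomial σ K)} (hQ : IsGradedIdeal Q)
    {t : σ} (hreg : IsRegularMod Q (X t)) {i j : ℕ} {c : Finset σ → MvPolynomial σ K}
    (hc : c ∈ idealChains ⊤ i j) (hDc : koszulD K σ (MvPolynomial σ K) c ∈ chainsIn Q)
    (h : ∃ b ∈ idealBoundaries ⊤ i j, c - b ∈ chainsIn (Q ⊔ Ideal.span {X t})) :
    ∃ b ∈ idealBoundaries ⊤ i j, c - b ∈ chainsIn Q := by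
  obtain ⟨b, hb, hcb⟩ := h
  have hcb' := Submodule.sub_mem _ hc (idealBoundaries_le _ _ _ hb)
  cases j with
  | zero => exact ⟨b, hb, chainsIn_of_lt hQ (isHomogeneous_X K t) hcb' hcb one_pos⟩
  | succ j =>
    obtain ⟨g, hg, hcg⟩ := exists_idealChains_sub_smul hQ (isHomogeneous_X K t) hcb' hcb
    have hDg : koszulD K σ (MvPolynomial σ K) g ∈ chainsIn Q := hreg.chainsIn (by
      have := Submodule.sub_mem _ hDc (koszulD_mem_chainsIn hcg)
      rwa [map_sub, map_sub, koszulD_idealBoundaries hb, sub_zero, sub_sub_cancel, map_smul]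
        at this)
    -- Modulo `Q`, `c - b` is `X t • g` with `g` a cycle, and the homotopy makes `X t • g` the
    -- boundary of `koszulWedge t g`.
    refine ⟨b + koszulD K σ (MvPolynomial σ K) (koszulWedge t g), Submodule.add_mem _ hb
      (mem_idealBoundaries_succ.2 ⟨_, koszulWedge_mem_idealChains t hg, rfl⟩), ?_⟩
    have := Submodule.add_mem _ hcg (koszulWedge_mem_chainsIn t hDg)
    rw [← koszulD_koszulWedge] at this
    convert this using 1
    abel

theorem RegLT.of_sup_span_X {Q : Ideal (MvPolynomial σ K)} (hQ : IsGradedIdeal Q)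
    {t : σ} (hreg : IsRegularMod Q (X t)) {r : ℕ} (h : RegLT ⊤ (Q ⊔ Ideal.span {X t}) r) :
    RegLT ⊤ Q r := fun i j hj c hc hDc =>
  exists_boundary_of_isRegularMod_X hQ hreg hc hDc
    (h i j hj c hc (chainsIn_mono le_sup_left hDc))

/-- If `f` is a quadric regular on `S / Q`, then `Tor_{i+1}(S / (Q + (f)), K)_{d+2}` surjects onto
`Tor_i(S / Q, K)_d`. -/
theorem KoszulVanishes.of_sup_span_quadric {Q : Ideal (MvPolynomial σ K)} (hQ : IsGradedIdeal Q)
    {s t : σ} {a b : MvPolynomial σ K} (ha : a.IsHomogeneous 1) (hb : b.IsHomogeneous 1)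
    (hreg : IsRegularMod Q (a * X s - b * X t)) {i j : ℕ}
    (h : KoszulVanishes ⊤ (Q ⊔ Ideal.span {a * X s - b * X t}) (i + 1) (j + 1)) :
    KoszulVanishes ⊤ Q i j := by
  intro c hc hDc
  set f := a * X s - b * X t with hf
  have hfhom : f.IsHomogeneous 2 := (ha.mul (isHomogeneous_X K s)).sub (hb.mul (isHomogeneous_X K t))
  -- `H` is a null-homotopy for multiplication by `f`, so `H c` is a cycle modulo `Q + (f)` lifting
  -- the class of `c`.
  let H : (Finset σ → MvPolynomial σ K) → (Finset σ → MvPolynomial σ K) := fun c =>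
    a • koszulWedge s c - b • koszulWedge t c
  have hH : koszulD K σ _ (H c) + H (koszulD K σ _ c) = f • c := by
    simp only [H, map_sub, map_smul, hf, sub_smul, mul_smul, ← koszulD_koszulWedge, smul_add]
    abel
  have hHD : H (koszulD K σ _ c) ∈ chainsIn Q := Submodule.sub_mem _
    (Submodule.smul_mem _ _ (koszulWedge_mem_chainsIn _ hDc))
    (Submodule.smul_mem _ _ (koszulWedge_mem_chainsIn _ hDc))
  have hHc : H c ∈ idealChains ⊤ (i + 1) (j + 1) := Submodule.sub_mem _
    (smul_mem_idealChains ha (koszulWedge_mem_idealChains _ hc))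
    (smul_mem_idealChains hb (koszulWedge_mem_idealChains _ hc))
  have hfc : f • c ∈ chainsIn (Ideal.span {f}) := mem_chainsIn.2 fun T =>
    Ideal.mul_mem_right _ _ (Ideal.mem_span_singleton_self f)
  obtain ⟨b₀, hb₀, hcb⟩ := h (H c) hHc (by
    have := Submodule.sub_mem _ (chainsIn_mono (le_sup_right (a := Q)) hfc)
      (chainsIn_mono (le_sup_left (b := Ideal.span {f})) hHD)
    rwa [← hH, add_sub_cancel_right] at this)
  have hcb' := Submodule.sub_mem _ hHc (idealBoundaries_le _ _ _ hb₀)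
  -- Writing `H c` as a boundary plus `f • g` modulo `Q` and applying the differential gives `f • c
  -- ≡ f • D g`, and `f` cancels. For `j = 0` the remainder has degree 1 < 2, so no multiple of `f`
  -- occurs.
  have key : ∃ g ∈ idealBoundaries ⊤ i j, koszulD K σ _ (H c) - f • g ∈ chainsIn Q := by
    cases j with
    | zero =>
      refine ⟨0, Submodule.zero_mem _, ?_⟩
      have := koszulD_mem_chainsIn (chainsIn_of_lt hQ hfhom hcb' hcb one_lt_two)
      rw [map_sub, koszulD_idealBoundaries hb₀] at this
      simpa using this
    | succ j =>
      obtain ⟨g, hg, hcg⟩ := exists_idealChains_sub_smul hQ hfhom hcb' hcb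
      refine ⟨_, mem_idealBoundaries_succ.2 ⟨g, hg, rfl⟩, ?_⟩
      have := koszulD_mem_chainsIn hcg
      rwa [map_sub, map_sub, koszulD_idealBoundaries hb₀, sub_zero, map_smul] at this
  obtain ⟨g, hg, hgQ⟩ := key
  refine ⟨g, hg, hreg.chainsIn ?_⟩
  have := Submodule.add_mem _ hgQ hHD
  rw [smul_sub, ← hH]
  convert this using 1
  abel

end RegularityBounds

/-! ### Division by a variable as a test for regularity -/

section DivX

variable {K σ : Type*} [Field K]

/-- The `K`-linear operator which sends `X t * m` to `m` and kills monomials not divisible by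
`X t`. -/
def divX (t : σ) : MvPolynomial σ K →+ MvPolynomial σ K where
  toFun p := p.divMonomial (Finsupp.single t 1)
  map_zero' := zero_divMonomial _
  map_add' _ _ := add_divMonomial _ _ _

theorem divX_X_mul (t : σ) (p : MvPolynomial σ K) : divX t (X t * p) = p :=
  X_mul_divMonomial t p

theorem divX_X_mul_of_ne {s t : σ} (h : s ≠ t) (p : MvPolynomial σ K) :
    divX t (X s * p) = X s * divX t p := by
  classical
  ext m
  change coeff m ((X s * p).divMonomial _) = coeff m (X s * p.divMonomial _)
  rw [coeff_divMonomial, coeff_X_mul', coeff_X_mul', coeff_divMonomial]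
  have hs : s ∈ (Finsupp.single t 1 + m).support ↔ s ∈ m.support := by
    simp [h.symm]
  simp only [hs]
  split_ifs with hm
  · congr 1
    rw [add_tsub_assoc_of_le]
    rw [Finsupp.single_le_iff]
    exact Nat.one_le_iff_ne_zero.2 (Finsupp.mem_support_iff.1 hm)
  · rfl

theorem iterate_divX (t : σ) (N : ℕ) (p : MvPolynomial σ K) :
    (divX t)^[N] p = p.divMonomial (Finsupp.single t N) := by
  induction N generalizing p with
  | zero => rw [Finsupp.single_zero, divMonomial_zero]; rfl
  | succ N ih =>
    rw [Function.iterate_succ_apply, ih, add_comm, Finsupp.single_add, divMonomial_add]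
    rfl

theorem exists_iterate_divX_eq_zero (t : σ) (p : MvPolynomial σ K) :
    ∃ N, (divX t)^[N] p = 0 := by
  refine ⟨p.totalDegree + 1, ?_⟩
  rw [iterate_divX]
  ext m
  rw [coeff_divMonomial, coeff_zero]
  by_contra h
  have := le_totalDegree (mem_support_iff.2 h)
  rw [Finsupp.sum_add_index' (by simp) (by simp), Finsupp.sum_single_index rfl] at this
  omega

/-- `I` is stable under division by `X t`. -/
def DivXStable (t : σ) (I : Ideal (MvPolynomial σ K)) : Prop := ∀ p ∈ I, divX t p ∈ I

theorem DivXStable.isRegularMod {t : σ} {I : Ideal (MvPolynomial σ K)} (h : DivXStable t I) :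
    IsRegularMod I (X t) := fun p hp => by
  simpa only [divX_X_mul] using h _ hp

theorem DivXStable.sup {t : σ} {I J : Ideal (MvPolynomial σ K)} (hI : DivXStable t I)
    (hJ : DivXStable t J) : DivXStable t (I ⊔ J) := fun p hp => by
  obtain ⟨a, ha, b, hb, rfl⟩ := Submodule.mem_sup.1 hp
  rw [map_add]
  exact Submodule.add_mem_sup (hI a ha) (hJ b hb)

theorem divXStable_bot (t : σ) : DivXStable t (⊥ : Ideal (MvPolynomial σ K)) := fun p hp => by
  rw [(Submodule.mem_bot _).1 hp, map_zero]; exact Submodule.zero_mem _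

theorem divXStable_span {t : σ} {s : Set (MvPolynomial σ K)}
    (h : ∀ g ∈ s, ∀ p, divX t (g * p) = g * divX t p) : DivXStable t (Ideal.span s) := by
  intro p hp
  -- `divX t` is not `S`-linear; the free multiplier `q` absorbs the scalar in the `smul` case.
  suffices H : ∀ q, divX t (q * p) ∈ Ideal.span s by simpa using H 1
  induction hp using Submodule.span_induction with
  | mem g hg =>
    intro q
    rw [mul_comm, h g hg]
    exact Ideal.mul_mem_right _ _ (Ideal.subset_span hg)
  | zero => intro q; rw [mul_zero, map_zero]; exact Ideal.zero_mem _
  | add a b _ _ ha hb => intro q; rw [mul_add, map_add]; exact Ideal.add_mem _ (ha q) (hb q)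
  | smul a b _ hb => intro q; rw [smul_eq_mul, ← mul_assoc]; exact hb _

theorem divXStable_span_X {t : σ} {A : Set σ} (h : t ∉ A) :
    DivXStable t (Ideal.span ((X : σ → MvPolynomial σ K) '' A)) := by
  apply divXStable_span
  rintro _ ⟨s, hs, rfl⟩ p
  exact divX_X_mul_of_ne (fun e => h (by rwa [← e])) p

end DivX

/-! ### The polynomial ring has regularity zero -/

section VariableIdeals

variable {K σ : Type*} [Field K]

theorem isGradedIdeal_span_X (A : Set σ) :
    IsGradedIdeal (Ideal.span ((X : σ → MvPolynomial σ K) '' A)) :=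
  isGradedIdeal_span (by rintro _ ⟨s, -, rfl⟩; exact ⟨1, isHomogeneous_X K s⟩)

theorem span_X_insert (t : σ) (A : Set σ) :
    Ideal.span ((X : σ → MvPolynomial σ K) '' insert t A) =
      Ideal.span (X '' A) ⊔ Ideal.span {X t} := by
  rw [Set.image_insert_eq, Set.insert_eq, Ideal.span_union, sup_comm]

variable [Fintype σ] [LinearOrder σ]

/-- `S` has regularity zero. -/
theorem regLT_top_bot : RegLT (⊤ : Ideal (MvPolynomial σ K)) ⊥ 1 := by
  -- Start from the residue field, where forms of positive degree vanish, and free the variables in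
  -- `B` one by one; each step injects on Tor.
  suffices H : ∀ B : Finset σ, RegLT (⊤ : Ideal (MvPolynomial σ K))
      (Ideal.span (X '' ((B : Set σ)ᶜ))) 1 by
    simpa using H Finset.univ
  intro B
  induction B using Finset.induction_on with
  | empty =>
    intro i j hj c hc _
    refine ⟨0, Submodule.zero_mem _, mem_chainsIn.2 fun T => ?_⟩
    rw [sub_zero, mem_ideal_span_X_image]
    intro m hm
    have := (hc T).2.1 (mem_support_iff.1 hm)
    by_contra! h
    have hm0 : m = 0 := by ext s; simpa using h s (by simp)
    subst hm0
    simp at this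
    omega
  | insert t B ht ih =>
    refine RegLT.of_sup_span_X (isGradedIdeal_span_X _)
      (divXStable_span_X (t := t) (by simp)).isRegularMod ?_
    rw [← span_X_insert]
    convert ih using 4
    ext s
    by_cases h : s = t <;> simp [h, ht]

end VariableIdeals

/-! ### Binomials in two fresh variables -/

section LinearRelation

variable {K σ : Type*} [Field K] {Q : Ideal (MvPolynomial σ K)} {s t : σ} {a b : MvPolynomial σ K}

/-- The part of the relation free of `X t` again lies in `Q`; it is `X s * a` times the part of `p`
free of `X t`, and both factors cancel. The term `X t * g` lets the lemma serve both results below.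
-/
theorem DivXStable.sub_mem_of_mul_add_mem (hs : DivXStable s Q) (ht : DivXStable t Q) (hst : s ≠ t)
    (ha : ∀ p, divX t (a * p) = a * divX t p) (hreg : IsRegularMod Q a)
    {p g : MvPolynomial σ K} (h : (X s * a - b * X t) * p + X t * g ∈ Q) :
    p - X t * divX t p ∈ Q := by
  refine hreg _ (hs.isRegularMod _ ?_)
  have h' := Q.sub_mem h (Q.mul_mem_left (X t) (ht _ h))
  have e : (X s * a - b * X t) * p + X t * g = X s * (a * p) - X t * (b * p - g) := by ring
  rw [e, map_sub, divX_X_mul_of_ne hst, ha, divX_X_mul] at h'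
  convert h' using 1
  ring

/-- Induction on the degree of `p` in `X t`: its part free of `X t` lies in `Q`, and the rest is `X
t * divX t p`, from which `X t` cancels. -/
theorem DivXStable.isRegularMod_linear (hs : DivXStable s Q) (ht : DivXStable t Q) (hst : s ≠ t)
    (ha : ∀ p, divX t (a * p) = a * divX t p) (hreg : IsRegularMod Q a) :
    IsRegularMod Q (X s * a - b * X t) := by
  intro p hp
  obtain ⟨N, hN⟩ := exists_iterate_divX_eq_zero t p
  induction N generalizing p with
  | zero => rw [show p = 0 from hN]; exact Q.zero_mem
  | succ N ih =>
    have h1 := hs.sub_mem_of_mul_add_mem (p := p) (g := 0) (b := b) ht hst ha hreg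
      (by simpa using hp)
    have h2 : divX t p ∈ Q := by
      refine ih _ (ht.isRegularMod _ ?_) hN
      have := Q.sub_mem hp (Q.mul_mem_left (X s * a - b * X t) h1)
      convert this using 1
      ring
    have := Q.add_mem h1 (Q.mul_mem_left (X t) h2)
    rwa [sub_add_cancel] at this

/-- If `X t * p` is `h` times the binomial modulo `Q`, then `h ≡ X t * divX t h`, and cancelling `X
t` exhibits `p` as a multiple of the binomial. -/
theorem DivXStable.isRegularMod_X_sup_span (hs : DivXStable s Q) (ht : DivXStable t Q)
    (hst : s ≠ t) (ha : ∀ p, divX t (a * p) = a * divX t p) (hreg : IsRegularMod Q a) :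
    IsRegularMod (Q ⊔ Ideal.span {X s * a - b * X t}) (X t) := by
  intro p hp
  obtain ⟨q, hq, fh, hfh, e⟩ := Submodule.mem_sup.1 hp
  obtain ⟨h, rfl⟩ := Ideal.mem_span_singleton'.1 hfh
  have h1 := hs.sub_mem_of_mul_add_mem (p := h) (g := -p) (b := b) ht hst ha hreg (by
    have := Q.neg_mem hq
    convert this using 1
    linear_combination e)
  have h2 : p - (X s * a - b * X t) * divX t h ∈ Q := by
    refine ht.isRegularMod _ ?_
    have := Q.add_mem hq (Q.mul_mem_left (X s * a - b * X t) h1)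
    convert this using 1
    linear_combination -e
  have := Ideal.add_mem (Q ⊔ Ideal.span {X s * a - b * X t}) (Ideal.mem_sup_left h2)
    (Ideal.mem_sup_right (Ideal.mul_mem_right (divX t h) _ (Ideal.mem_span_singleton_self _)))
  rwa [sub_add_cancel] at this

end LinearRelation

/-! ### Binomial edge ideals and isolated vertices -/

section EdgeIdeals

variable {K : Type*} [Field K] {n : ℕ}

variable (K) in
/-- The binomial `x_i y_j - x_j y_i`. -/
def edgeBinomial (i j : Fin n) : MvPolynomial (EdgeVar n) K :=
  xVar K i * yVar K j - xVar K j * yVar K i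

theorem edgeBinomial_swap (i j : Fin n) : edgeBinomial K j i = -edgeBinomial K i j := by
  simp only [edgeBinomial]; ring

theorem isHomogeneous_edgeBinomial (i j : Fin n) : (edgeBinomial K i j).IsHomogeneous 2 :=
  ((isHomogeneous_X K _).mul (isHomogeneous_X K _)).sub
    ((isHomogeneous_X K _).mul (isHomogeneous_X K _))

theorem edgeBinomial_mem {G : SimpleGraph (Fin n)} {i j : Fin n} (h : G.Adj i j) :
    edgeBinomial K i j ∈ binomialEdgeIdeal K G := Ideal.subset_span ⟨i, j, h, rfl⟩

theorem binomialEdgeIdeal_le {G : SimpleGraph (Fin n)} {I : Ideal (MvPolynomial (EdgeVar n) K)} :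
    binomialEdgeIdeal K G ≤ I ↔ ∀ i j, G.Adj i j → edgeBinomial K i j ∈ I := by
  rw [binomialEdgeIdeal, Ideal.span_le]
  constructor
  · exact fun h i j hij => h ⟨i, j, hij, rfl⟩
  · rintro h _ ⟨i, j, hij, rfl⟩
    exact h i j hij

theorem binomialEdgeIdeal_mono {G H : SimpleGraph (Fin n)} (h : G ≤ H) :
    binomialEdgeIdeal K G ≤ binomialEdgeIdeal K H :=
  binomialEdgeIdeal_le.2 fun _ _ hij => edgeBinomial_mem (h hij)

theorem binomialEdgeIdeal_bot : binomialEdgeIdeal K (⊥ : SimpleGraph (Fin n)) = ⊥ :=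
  le_bot_iff.1 (binomialEdgeIdeal_le.2 fun _ _ h => h.elim)

theorem binomialEdgeIdeal_sup_edge (G : SimpleGraph (Fin n)) {u v : Fin n} (h : u ≠ v) :
    binomialEdgeIdeal K (G ⊔ SimpleGraph.edge u v) =
      binomialEdgeIdeal K G ⊔ Ideal.span {edgeBinomial K u v} := by
  apply le_antisymm
  · refine binomialEdgeIdeal_le.2 fun i j hij => ?_
    rcases hij with hij | hij
    · exact Ideal.mem_sup_left (edgeBinomial_mem hij)
    · refine Ideal.mem_sup_right ?_
      rcases (SimpleGraph.edge_adj ..).1 hij with ⟨⟨rfl, rfl⟩ | ⟨hi, hj⟩, -⟩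
      · exact Ideal.mem_span_singleton_self _
      · rw [← hi, ← hj, edgeBinomial_swap j i]
        exact Submodule.neg_mem _ (Ideal.mem_span_singleton_self _)
  · refine sup_le (binomialEdgeIdeal_mono le_sup_left) ?_
    rw [Ideal.span_singleton_le_iff_mem]
    exact edgeBinomial_mem (Or.inr ((SimpleGraph.edge_adj ..).2 ⟨Or.inl ⟨rfl, rfl⟩, h⟩))

theorem isGradedIdeal_binomialEdgeIdeal (G : SimpleGraph (Fin n)) :
    IsGradedIdeal (binomialEdgeIdeal K G) :=
  isGradedIdeal_span (by rintro _ ⟨i, j, -, rfl⟩; exact ⟨2, isHomogeneous_edgeBinomial i j⟩)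

theorem xVar_ne {i j : Fin n} (h : i ≠ j) : Sum.inlₗ i ≠ (Sum.inlₗ j : EdgeVar n) :=
  fun e => h (Sum.inl_injective (toLex.injective e))

theorem yVar_ne {i j : Fin n} (h : i ≠ j) : Sum.inrₗ i ≠ (Sum.inrₗ j : EdgeVar n) :=
  fun e => h (Sum.inr_injective (toLex.injective e))

theorem xVar_ne_yVar (i j : Fin n) : Sum.inlₗ i ≠ (Sum.inrₗ j : EdgeVar n) :=
  fun e => Sum.inl_ne_inr (toLex.injective e)

theorem divX_edgeBinomial_mul {t : EdgeVar n} {i j : Fin n} (hi : Sum.inlₗ i ≠ t)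
    (hi' : Sum.inrₗ i ≠ t) (hj : Sum.inlₗ j ≠ t) (hj' : Sum.inrₗ j ≠ t)
    (p : MvPolynomial (EdgeVar n) K) :
    divX t (edgeBinomial K i j * p) = edgeBinomial K i j * divX t p := by
  simp only [edgeBinomial, xVar, yVar, sub_mul, map_sub, mul_assoc, divX_X_mul_of_ne hi,
    divX_X_mul_of_ne hi', divX_X_mul_of_ne hj, divX_X_mul_of_ne hj']

theorem divXStable_xVar_binomialEdgeIdeal {G : SimpleGraph (Fin n)} {v : Fin n}
    (h : ∀ w, ¬G.Adj v w) : DivXStable (Sum.inlₗ v) (binomialEdgeIdeal K G) := by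
  apply divXStable_span
  rintro _ ⟨i, j, hij, rfl⟩ p
  have hi : i ≠ v := by rintro rfl; exact h _ hij
  have hj : j ≠ v := by rintro rfl; exact h _ hij.symm
  exact divX_edgeBinomial_mul (xVar_ne hi) (xVar_ne_yVar _ _).symm (xVar_ne hj)
    (xVar_ne_yVar _ _).symm p

theorem divXStable_yVar_binomialEdgeIdeal {G : SimpleGraph (Fin n)} {v : Fin n}
    (h : ∀ w, ¬G.Adj v w) : DivXStable (Sum.inrₗ v) (binomialEdgeIdeal K G) := by
  apply divXStable_span
  rintro _ ⟨i, j, hij, rfl⟩ p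
  have hi : i ≠ v := by rintro rfl; exact h _ hij
  have hj : j ≠ v := by rintro rfl; exact h _ hij.symm
  exact divX_edgeBinomial_mul (xVar_ne_yVar _ _) (yVar_ne hi) (xVar_ne_yVar _ _) (yVar_ne hj) p

variable (K) in
/-- The ideal `(x_v, y_v)`. -/
def vertexIdeal (v : Fin n) : Ideal (MvPolynomial (EdgeVar n) K) :=
  Ideal.span {xVar K v} ⊔ Ideal.span {yVar K v}

theorem xVar_mem_vertexIdeal (v : Fin n) : xVar K v ∈ vertexIdeal K v :=
  Ideal.mem_sup_left (Ideal.mem_span_singleton_self _)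

theorem yVar_mem_vertexIdeal (v : Fin n) : yVar K v ∈ vertexIdeal K v :=
  Ideal.mem_sup_right (Ideal.mem_span_singleton_self _)

theorem edgeBinomial_mem_vertexIdeal (v w : Fin n) : edgeBinomial K v w ∈ vertexIdeal K v :=
  Ideal.sub_mem _ (Ideal.mul_mem_right _ _ (xVar_mem_vertexIdeal v))
    (Ideal.mul_mem_left _ _ (yVar_mem_vertexIdeal v))

theorem isGradedIdeal_span_xVar (v : Fin n) : IsGradedIdeal (Ideal.span {xVar K v}) :=
  isGradedIdeal_span (by rintro _ rfl; exact ⟨1, isHomogeneous_X K _⟩)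

theorem isGradedIdeal_span_yVar (v : Fin n) : IsGradedIdeal (Ideal.span {yVar K v}) :=
  isGradedIdeal_span (by rintro _ rfl; exact ⟨1, isHomogeneous_X K _⟩)

theorem isGradedIdeal_vertexIdeal (v : Fin n) : IsGradedIdeal (vertexIdeal K v) :=
  (isGradedIdeal_span_xVar v).sup (isGradedIdeal_span_yVar v)

theorem divXStable_yVar_span_xVar (v w : Fin n) :
    DivXStable (Sum.inrₗ v) (Ideal.span {xVar K w}) := by
  apply divXStable_span
  rintro _ rfl p
  exact divX_X_mul_of_ne (xVar_ne_yVar _ _) p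

/-- Adding `x_v` and `y_v` for an isolated vertex does not increase the regularity. -/
theorem RegLT.sup_vertexIdeal {G : SimpleGraph (Fin n)} {v : Fin n} (hv : ∀ w, ¬G.Adj v w) {r : ℕ}
    (h : RegLT ⊤ (binomialEdgeIdeal K G) r) :
    RegLT ⊤ (binomialEdgeIdeal K G ⊔ vertexIdeal K v) r := by
  rw [vertexIdeal, ← sup_assoc]
  refine RegLT.sup_span (e := 0) ((isGradedIdeal_binomialEdgeIdeal G).sup
    (isGradedIdeal_span_xVar v)) (isHomogeneous_X K _) (DivXStable.isRegularMod
      ((divXStable_yVar_binomialEdgeIdeal hv).sup (divXStable_yVar_span_xVar v v))) ?_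
  exact h.sup_span (e := 0) (isGradedIdeal_binomialEdgeIdeal G) (isHomogeneous_X K _)
    (divXStable_xVar_binomialEdgeIdeal hv).isRegularMod

end EdgeIdeals

/-! ### Completing the neighbourhood of a vertex -/

section Completion

variable {K : Type*} [Field K] {n : ℕ}

/-- The graph obtained from `G` by removing all edges at `v`. -/
def isolateVertex (G : SimpleGraph (Fin n)) (v : Fin n) : SimpleGraph (Fin n) where
  Adj i j := G.Adj i j ∧ i ≠ v ∧ j ≠ v
  symm := ⟨fun _ _ h => ⟨h.1.symm, h.2.2, h.2.1⟩⟩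
  loopless := ⟨fun _ h => h.1.ne rfl⟩

/-- The graph obtained from `G` by making the neighbourhood of `v` a clique. -/
def completeNeighborhood (G : SimpleGraph (Fin n)) (v : Fin n) : SimpleGraph (Fin n) where
  Adj i j := i ≠ j ∧ (G.Adj i j ∨ (G.Adj v i ∧ G.Adj v j))
  symm := ⟨fun _ _ h => ⟨h.1.symm, h.2.imp (·.symm) (·.symm)⟩⟩
  loopless := ⟨fun _ h => h.1 rfl⟩

theorem not_isolateVertex_adj (G : SimpleGraph (Fin n)) (v w : Fin n) :
    ¬(isolateVertex G v).Adj v w := fun h => h.2.1 rfl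

theorem isolateVertex_le (G : SimpleGraph (Fin n)) (v : Fin n) : isolateVertex G v ≤ G :=
  fun _ _ h => h.1

theorem le_completeNeighborhood (G : SimpleGraph (Fin n)) (v : Fin n) :
    G ≤ completeNeighborhood G v := fun _ _ h => ⟨h.ne, Or.inl h⟩

theorem binomialEdgeIdeal_le_isolateVertex_sup (G : SimpleGraph (Fin n)) (v : Fin n) :
    binomialEdgeIdeal K G ≤ binomialEdgeIdeal K (isolateVertex G v) ⊔ vertexIdeal K v := by
  refine binomialEdgeIdeal_le.2 fun i j hij => ?_
  by_cases hi : i = v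
  · subst hi; exact Ideal.mem_sup_right (edgeBinomial_mem_vertexIdeal _ _)
  by_cases hj : j = v
  · subst hj
    rw [edgeBinomial_swap]
    exact Ideal.mem_sup_right (neg_mem_iff.2 (edgeBinomial_mem_vertexIdeal _ _))
  exact Ideal.mem_sup_left (edgeBinomial_mem ⟨hij, hi, hj⟩)

variable (K) in
/-- The substitution `x_v = y_v = 0`. -/
def killVertex (v : Fin n) : MvPolynomial (EdgeVar n) K →ₐ[K] MvPolynomial (EdgeVar n) K :=
  aeval fun s => if s = Sum.inlₗ v ∨ s = Sum.inrₗ v then 0 else X s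

theorem sub_killVertex_mem (v : Fin n) (p : MvPolynomial (EdgeVar n) K) :
    p - killVertex K v p ∈ vertexIdeal K v := by
  have h : (Ideal.Quotient.mkₐ K (vertexIdeal K v)).comp (killVertex K v) =
      Ideal.Quotient.mkₐ K (vertexIdeal K v) := by
    refine algHom_ext fun s => ?_
    simp only [AlgHom.comp_apply, killVertex, aeval_X]
    split_ifs with hs
    · rw [map_zero, eq_comm]
      refine Ideal.Quotient.eq_zero_iff_mem.2 ?_
      rcases hs with rfl | rfl
      · exact xVar_mem_vertexIdeal v
      · exact yVar_mem_vertexIdeal v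
    · rfl
  exact Ideal.Quotient.eq.1 (DFunLike.congr_fun h p).symm

theorem killVertex_edgeBinomial {v i j : Fin n} (hi : i ≠ v) (hj : j ≠ v) :
    killVertex K v (edgeBinomial K i j) = edgeBinomial K i j := by
  simp only [edgeBinomial, xVar, yVar, killVertex, map_sub, map_mul, aeval_X]
  simp [hi, hj]

theorem killVertex_mem {G : SimpleGraph (Fin n)} {v : Fin n} {p : MvPolynomial (EdgeVar n) K}
    (hp : p ∈ binomialEdgeIdeal K (isolateVertex G v) ⊔ vertexIdeal K v) :
    killVertex K v p ∈ binomialEdgeIdeal K (isolateVertex G v) := by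
  suffices H : binomialEdgeIdeal K (isolateVertex G v) ⊔ vertexIdeal K v ≤
      (binomialEdgeIdeal K (isolateVertex G v)).comap (killVertex K v) from H hp
  refine sup_le (binomialEdgeIdeal_le.2 fun i j hij => ?_) (sup_le ?_ ?_)
  · rw [Ideal.mem_comap, killVertex_edgeBinomial hij.2.1 hij.2.2]
    exact edgeBinomial_mem hij
  · rw [Ideal.span_singleton_le_iff_mem, Ideal.mem_comap]
    simp [killVertex, xVar]
  · rw [Ideal.span_singleton_le_iff_mem, Ideal.mem_comap]
    simp [killVertex, yVar]

/-- If `i`, `j` are neighbours of `v`, then `(x_v, y_v)` multiplies `x_i y_j - x_j y_i` into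
`J_G`. -/
theorem mul_edgeBinomial_mem {G : SimpleGraph (Fin n)} {v i j : Fin n} (hi : G.Adj v i)
    (hj : G.Adj v j) {a : MvPolynomial (EdgeVar n) K} (ha : a ∈ vertexIdeal K v) :
    a * edgeBinomial K i j ∈ binomialEdgeIdeal K G := by
  obtain ⟨b, hb, c, hc, rfl⟩ := Submodule.mem_sup.1 ha
  obtain ⟨b, rfl⟩ := Ideal.mem_span_singleton'.1 hb
  obtain ⟨c, rfl⟩ := Ideal.mem_span_singleton'.1 hc
  have e : (b * xVar K v + c * yVar K v) * edgeBinomial K i j =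
      (b * xVar K i + c * yVar K i) * edgeBinomial K v j -
        (b * xVar K j + c * yVar K j) * edgeBinomial K v i := by
    simp only [edgeBinomial]; ring
  rw [e]
  exact Ideal.sub_mem _ (Ideal.mul_mem_left _ _ (edgeBinomial_mem hj))
    (Ideal.mul_mem_left _ _ (edgeBinomial_mem hi))

/-- Modulo `J_G`, an element of the intersection is a combination `w` of binomials on pairs of
neighbours of `v`. Setting `x_v = y_v = 0` changes `w` only by elements of `J_G`, and sends it into
the ideal of `G` without `v`. -/
theorem binomialEdgeIdeal_eq_inf (G : SimpleGraph (Fin n)) (v : Fin n) :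
    binomialEdgeIdeal K (completeNeighborhood G v) ⊓
      (binomialEdgeIdeal K (isolateVertex G v) ⊔ vertexIdeal K v) = binomialEdgeIdeal K G := by
  refine le_antisymm ?_ (le_inf (binomialEdgeIdeal_mono (le_completeNeighborhood G v))
    (binomialEdgeIdeal_le_isolateVertex_sup G v))
  rintro h ⟨h₁, h₂⟩
  set F : Ideal (MvPolynomial (EdgeVar n) K) :=
    Ideal.span {f | ∃ i j, G.Adj v i ∧ G.Adj v j ∧ f = edgeBinomial K i j} with hF
  have hle : binomialEdgeIdeal K (completeNeighborhood G v) ≤ binomialEdgeIdeal K G ⊔ F := by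
    refine binomialEdgeIdeal_le.2 fun i j hij => ?_
    rcases hij.2 with hij | ⟨hi, hj⟩
    · exact Ideal.mem_sup_left (edgeBinomial_mem hij)
    · exact Ideal.mem_sup_right (Ideal.subset_span ⟨i, j, hi, hj, rfl⟩)
  obtain ⟨g, hg, w, hw, rfl⟩ := Submodule.mem_sup.1 (hle h₁)
  have hw₁ : w - killVertex K v w ∈ binomialEdgeIdeal K G := by
    suffices H : ∀ q, q * w - killVertex K v (q * w) ∈ binomialEdgeIdeal K G by simpa using H 1
    clear h₁ h₂
    rw [hF] at hw
    induction hw using Submodule.span_induction with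
    | mem f hf =>
      obtain ⟨i, j, hi, hj, rfl⟩ := hf
      intro q
      rw [map_mul, killVertex_edgeBinomial hi.ne' hj.ne', ← sub_mul]
      exact mul_edgeBinomial_mem hi hj (sub_killVertex_mem v q)
    | zero => intro q; simp
    | add a b _ _ ha hb =>
      intro q
      rw [mul_add, map_add, add_sub_add_comm]
      exact Ideal.add_mem _ (ha q) (hb q)
    | smul a b _ hb => intro q; rw [smul_eq_mul, ← mul_assoc]; exact hb _
  have hw₂ : killVertex K v w ∈ binomialEdgeIdeal K G := by
    refine binomialEdgeIdeal_mono (isolateVertex_le G v) (killVertex_mem ?_)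
    have := Ideal.sub_mem _ h₂ (binomialEdgeIdeal_le_isolateVertex_sup G v hg)
    rwa [add_sub_cancel_left] at this
  have := Ideal.add_mem _ hg (Ideal.add_mem _ hw₁ hw₂)
  rwa [sub_add_cancel] at this

theorem binomialEdgeIdeal_completeNeighborhood_sup (G : SimpleGraph (Fin n)) (v : Fin n) :
    binomialEdgeIdeal K (completeNeighborhood G v) ⊔
      (binomialEdgeIdeal K (isolateVertex G v) ⊔ vertexIdeal K v) =
    binomialEdgeIdeal K (isolateVertex (completeNeighborhood G v) v) ⊔ vertexIdeal K v := by
  apply le_antisymm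
  · refine sup_le (binomialEdgeIdeal_le_isolateVertex_sup _ _) (sup_le_sup_right ?_ _)
    exact binomialEdgeIdeal_mono fun i j h => ⟨le_completeNeighborhood G v h.1, h.2⟩
  · exact sup_le (le_sup_of_le_left (binomialEdgeIdeal_mono (isolateVertex_le _ _)))
      (le_sup_of_le_right le_sup_right)

/-- By the second isomorphism theorem the quotient is the kernel of a surjection between the residue
rings of the two smaller graphs with `x_v`, `y_v` killed. The connecting map accounts for `r + 1`.
-/
theorem regLT_completeNeighborhood_quotient {G : SimpleGraph (Fin n)} {v : Fin n} {r : ℕ}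
    (h₁ : RegLT ⊤ (binomialEdgeIdeal K (isolateVertex G v)) r)
    (h₂ : RegLT ⊤ (binomialEdgeIdeal K (isolateVertex (completeNeighborhood G v) v)) r) :
    RegLT (binomialEdgeIdeal K (completeNeighborhood G v)) (binomialEdgeIdeal K G) (r + 1) := by
  intro i j hj
  obtain ⟨j, rfl⟩ := Nat.exists_eq_add_of_le' (show 1 ≤ j by omega)
  rw [← binomialEdgeIdeal_eq_inf G v]
  refine KoszulVanishes.of_sup (isGradedIdeal_binomialEdgeIdeal _)
    ((isGradedIdeal_binomialEdgeIdeal _).sup (isGradedIdeal_vertexIdeal v)) ?_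
  refine KoszulVanishes.left le_sup_right le_top
    (h₁.sup_vertexIdeal (not_isolateVertex_adj G v) i (j + 1) (by omega)) ?_
  rw [binomialEdgeIdeal_completeNeighborhood_sup]
  exact h₂.sup_vertexIdeal (not_isolateVertex_adj _ v) (i + 1) j (by omega)

/-- Both directions matter: the bound descends from the closure to `G`, and ascends to the closure
from a path forest. -/
theorem regLT_completeNeighborhood_iff {G : SimpleGraph (Fin n)} {v : Fin n} {r : ℕ}
    (h₁ : RegLT ⊤ (binomialEdgeIdeal K (isolateVertex G v)) r)
    (h₂ : RegLT ⊤ (binomialEdgeIdeal K (isolateVertex (completeNeighborhood G v) v)) r) :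
    RegLT ⊤ (binomialEdgeIdeal K (completeNeighborhood G v)) (r + 1) ↔
      RegLT ⊤ (binomialEdgeIdeal K G) (r + 1) := by
  have hq := regLT_completeNeighborhood_quotient h₁ h₂
  have hle := binomialEdgeIdeal_mono (K := K) (le_completeNeighborhood G v)
  constructor
  · exact fun h i j hj => (hq i j hj).middle hle le_top (h i j hj)
  · intro h i j hj
    cases i with
    | zero => exact (h 0 j hj).right_zero hle
    | succ i => exact (h (i + 1) j hj).right hle le_top (hq i (j + 1) (by omega))

end Completion

/-! ### Path forests as complete intersections -/

section PathForests

variable {n : ℕ}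

/-- The graph joining consecutive members of a list which have the same colour. -/
def listGraph (c : Fin n → ℕ) : List (Fin n) → SimpleGraph (Fin n)
  | [] => ⊥
  | [_] => ⊥
  | v :: u :: l => if c v = c u then listGraph c (u :: l) ⊔ SimpleGraph.edge v u
      else listGraph c (u :: l)

theorem listGraph_adj {c : Fin n → ℕ} {l : List (Fin n)} {i j : Fin n}
    (h : (listGraph c l).Adj i j) : i ∈ l ∧ j ∈ l ∧ c i = c j := by
  induction l with
  | nil => exact h.elim
  | cons v l ih =>
    cases l with
    | nil => exact h.elim
    | cons u l =>
      have ih' : (listGraph c (u :: l)).Adj i j → i ∈ v :: u :: l ∧ j ∈ v :: u :: l ∧ c i = c j :=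
        fun h => ⟨List.mem_cons_of_mem _ (ih h).1, List.mem_cons_of_mem _ (ih h).2.1, (ih h).2.2⟩
      rw [listGraph] at h
      split_ifs at h with hc
      · rcases h with h | h
        · exact ih' h
        · rcases (SimpleGraph.edge_adj ..).1 h with ⟨⟨rfl, rfl⟩ | ⟨rfl, rfl⟩, -⟩ <;> simp [hc]
      · exact ih' h

theorem listGraph_le_cons (c : Fin n → ℕ) (v : Fin n) (l : List (Fin n)) :
    listGraph c l ≤ listGraph c (v :: l) := by
  cases l with
  | nil => exact bot_le
  | cons u l =>
    rw [listGraph]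
    split_ifs
    · exact le_sup_left
    · exact le_rfl

theorem listGraph_adj_getElem {c : Fin n → ℕ} {l : List (Fin n)} (hl : l.Nodup) {k : ℕ}
    (hk : k + 1 < l.length) (hc : c l[k] = c l[k + 1]) : (listGraph c l).Adj l[k] l[k + 1] := by
  induction l generalizing k with
  | nil => simp at hk
  | cons v l ih =>
    cases k with
    | zero =>
      cases l with
      | nil => simp at hk
      | cons u l =>
        have hc' : c v = c u := hc
        rw [listGraph, if_pos hc']
        refine Or.inr ((SimpleGraph.edge_adj ..).2 ⟨Or.inl ⟨rfl, rfl⟩, ?_⟩)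
        rintro (rfl : v = u)
        simp at hl
    | succ k =>
      exact listGraph_le_cons c v l (ih hl.of_cons (by simpa using hk) (by simpa using hc))

theorem listGraph_le {c : Fin n → ℕ} {l : List (Fin n)} {G : SimpleGraph (Fin n)}
    (h : l.IsChain G.Adj) : listGraph c l ≤ G := by
  induction l with
  | nil => exact bot_le
  | cons v l ih =>
    cases l with
    | nil => exact bot_le
    | cons u l =>
      rw [List.isChain_cons_cons] at h
      rw [listGraph]
      split_ifs
      · exact sup_le (ih h.2) ((SimpleGraph.edge_le_iff ..).2 (Or.inr h.1))
      · exact ih h.2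

theorem listGraph_reachable_head {c : Fin n → ℕ} {v : Fin n} {l : List (Fin n)}
    (hl : (v :: l).Pairwise (fun i j => c i ≤ c j)) {w : Fin n} (hw : w ∈ v :: l)
    (hc : c v = c w) : (listGraph c (v :: l)).Reachable v w := by
  induction l generalizing v with
  | nil => rw [List.mem_singleton.1 hw]
  | cons u l ih =>
    rcases List.mem_cons.1 hw with rfl | hw'
    · exact SimpleGraph.Reachable.refl _
    have hl' := List.pairwise_cons.1 hl
    have hvu : c v ≤ c u := hl'.1 u List.mem_cons_self
    -- Sortedness squeezes `c u` between the equal colours `c v` and `c w`.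
    have huw : c u ≤ c w := by
      rcases List.mem_cons.1 hw' with rfl | h
      · exact le_rfl
      · exact (List.pairwise_cons.1 hl'.2).1 w h
    have hcvu : c v = c u := by omega
    refine SimpleGraph.Reachable.trans (v := u) ?_
      ((ih hl'.2 hw' (by omega)).mono (listGraph_le_cons c v _))
    by_cases h : v = u
    · rw [h]
    · rw [listGraph, if_pos hcvu]
      exact SimpleGraph.Adj.reachable
        (Or.inr ((SimpleGraph.edge_adj ..).2 ⟨Or.inl ⟨rfl, rfl⟩, h⟩))

theorem listGraph_reachable {c : Fin n → ℕ} {l : List (Fin n)}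
    (hl : l.Pairwise (fun i j => c i ≤ c j)) {i j : Fin n} (hi : i ∈ l) (hj : j ∈ l)
    (hc : c i = c j) : (listGraph c l).Reachable i j := by
  induction l with
  | nil => simp at hi
  | cons v l ih =>
    rcases List.mem_cons.1 hi with rfl | hi'
    · exact listGraph_reachable_head hl hj hc
    rcases List.mem_cons.1 hj with rfl | hj'
    · exact (listGraph_reachable_head hl hi hc.symm).symm
    · exact (ih hl.of_cons hi' hj').mono (listGraph_le_cons c v l)

variable {K : Type*} [Field K]

/-- `v` is isolated in the graph of `u :: l`, so `x_v`, `y_v` are fresh. Regularity of the last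
`y`-variable is the invariant that lets the path grow. -/
theorem isRegularMod_listGraph {c : Fin n → ℕ} {v u : Fin n} {l : List (Fin n)}
    (hl : (v :: u :: l).Nodup)
    (hu : IsRegularMod (binomialEdgeIdeal K (listGraph c (u :: l))) (yVar K u)) :
    IsRegularMod (binomialEdgeIdeal K (listGraph c (u :: l))) (edgeBinomial K v u) ∧
      IsRegularMod (binomialEdgeIdeal K (listGraph c (v :: u :: l))) (yVar K v) := by
  have hv : ∀ w, ¬(listGraph c (u :: l)).Adj v w := fun w h =>
    (List.nodup_cons.1 hl).1 (listGraph_adj h).1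
  have hvu : v ≠ u := by rintro rfl; simp at hl
  have hs := divXStable_xVar_binomialEdgeIdeal (K := K) hv
  have ht := divXStable_yVar_binomialEdgeIdeal (K := K) hv
  have ha : ∀ p, divX (Sum.inrₗ v) (yVar K u * p) = yVar K u * divX (Sum.inrₗ v) p :=
    divX_X_mul_of_ne (yVar_ne hvu.symm)
  refine ⟨hs.isRegularMod_linear ht (xVar_ne_yVar _ _) ha hu, ?_⟩
  rw [listGraph]
  split_ifs
  · rw [binomialEdgeIdeal_sup_edge _ hvu]
    exact hs.isRegularMod_X_sup_span ht (xVar_ne_yVar _ _) ha hu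
  · exact ht.isRegularMod

theorem isRegularMod_yVar_listGraph {c : Fin n → ℕ} {v : Fin n} {l : List (Fin n)}
    (hl : (v :: l).Nodup) :
    IsRegularMod (binomialEdgeIdeal K (listGraph c (v :: l))) (yVar K v) := by
  induction l generalizing v with
  | nil =>
    rw [listGraph, binomialEdgeIdeal_bot]
    exact (divXStable_bot _).isRegularMod
  | cons u l ih => exact (isRegularMod_listGraph hl (ih hl.of_cons)).2

theorem regLT_listGraph {c : Fin n → ℕ} {v : Fin n} {l : List (Fin n)}
    (hl : (v :: l).Nodup) :
    RegLT ⊤ (binomialEdgeIdeal K (listGraph c (v :: l))) (v :: l).length := by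
  induction l generalizing v with
  | nil =>
    rw [listGraph, binomialEdgeIdeal_bot]
    exact regLT_top_bot
  | cons u l ih =>
    have h := ih hl.of_cons
    have hvu : v ≠ u := by rintro rfl; simp at hl
    rw [listGraph]
    split_ifs
    · rw [binomialEdgeIdeal_sup_edge _ hvu]
      exact h.sup_span (isGradedIdeal_binomialEdgeIdeal _) (isHomogeneous_edgeBinomial v u)
        (isRegularMod_listGraph hl (isRegularMod_yVar_listGraph hl.of_cons)).1
    · exact h.mono (Nat.le_succ _)

theorem not_koszulVanishes_top_bot {σ : Type*} [Fintype σ] [LinearOrder σ] :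
    ¬KoszulVanishes (⊤ : Ideal (MvPolynomial σ K)) ⊥ 0 0 := by
  intro h
  have hc : Pi.single ∅ 1 ∈ idealChains (⊤ : Ideal (MvPolynomial σ K)) 0 0 := by
    intro T
    by_cases hT : T = ∅
    · subst hT
      simpa using isHomogeneous_one σ K
    · simp [hT, isHomogeneous_zero]
  obtain ⟨b, hb, hcb⟩ := h _ hc (by
    rw [koszulD_eq_zero_of_idealChains_zero hc]; exact Submodule.zero_mem _)
  rw [(Submodule.mem_bot K).1 hb, sub_zero] at hcb
  simpa using mem_chainsIn.1 hcb ∅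

/-- The residue ring of a path with `m` edges has nonzero `Tor_m` in coefficient degree `m`. -/
theorem not_koszulVanishes_path {v : Fin n} {l : List (Fin n)} (hl : (v :: l).Nodup) :
    ¬KoszulVanishes ⊤ (binomialEdgeIdeal K (listGraph (fun _ => 0) (v :: l)))
      l.length l.length := by
  induction l generalizing v with
  | nil =>
    rw [listGraph, binomialEdgeIdeal_bot]
    exact not_koszulVanishes_top_bot
  | cons u l ih =>
    have hvu : v ≠ u := by rintro rfl; simp at hl
    rw [listGraph, if_pos rfl, binomialEdgeIdeal_sup_edge _ hvu]
    intro h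
    exact ih hl.of_cons (h.of_sup_span_quadric (isGradedIdeal_binomialEdgeIdeal _)
      (isHomogeneous_X K _) (isHomogeneous_X K _)
      (isRegularMod_listGraph hl (isRegularMod_yVar_listGraph hl.of_cons)).1)

end PathForests

/-! ### The upper bound -/

section UpperBound

variable {K : Type*} [Field K] {n : ℕ}

/-- The disjoint union of the complete graphs on the connected components of `G`. -/
def componentClosure (G : SimpleGraph (Fin n)) : SimpleGraph (Fin n) where
  Adj i j := i ≠ j ∧ G.Reachable i j
  symm := ⟨fun _ _ h => ⟨h.1.symm, h.2.symm⟩⟩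
  loopless := ⟨fun _ h => h.1 rfl⟩

theorem reachable_completeNeighborhood (G : SimpleGraph (Fin n)) (v i j : Fin n) :
    (completeNeighborhood G v).Reachable i j ↔ G.Reachable i j := by
  constructor
  · rintro ⟨w⟩
    induction w with
    | nil => exact SimpleGraph.Reachable.refl _
    | cons h _ ih =>
      refine SimpleGraph.Reachable.trans ?_ ih
      rcases h.2 with h | ⟨h₁, h₂⟩
      · exact h.reachable
      · exact h₁.symm.reachable.trans h₂.reachable
  · exact fun h => h.mono (le_completeNeighborhood G v)

theorem componentClosure_completeNeighborhood (G : SimpleGraph (Fin n)) (v : Fin n) :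
    componentClosure (completeNeighborhood G v) = componentClosure G := by
  ext i j
  simp only [componentClosure, reachable_completeNeighborhood]

theorem componentClosure_eq_self {G : SimpleGraph (Fin n)}
    (h : ∀ v, completeNeighborhood G v = G) : componentClosure G = G := by
  refine le_antisymm ?_ fun i j hij => ⟨hij.ne, hij.reachable⟩
  rintro i j ⟨hij, ⟨w⟩⟩
  induction w with
  | nil => exact absurd rfl hij
  | @cons i k j hik _ ih =>
    by_cases hkj : k = j
    · exact hkj ▸ hik
    · rw [← h k]
      exact ⟨hij, Or.inr ⟨hik.symm, ih hkj⟩⟩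

/-- The quotient of `S` by the binomial edge ideal of a graph whose edges lie in a nonempty
set `V` has regularity less than the cardinality of `V`. -/
theorem regLT_card (V : Finset (Fin n)) (hV : V.Nonempty) (G : SimpleGraph (Fin n))
    (hG : ∀ i j, G.Adj i j → i ∈ V) : RegLT ⊤ (binomialEdgeIdeal K G) V.card := by
  induction V using Finset.strongInduction generalizing G with
  | H V ih =>
  -- Inner induction upwards on `G`: the graph grows until it is stable under completion, while the
  -- outer induction handles the graphs with `v` isolated.
  have hcl : ∀ G : SimpleGraph (Fin n), (∀ i j, G.Adj i j → i ∈ V) →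
      (RegLT ⊤ (binomialEdgeIdeal K (componentClosure G)) V.card ↔
        RegLT ⊤ (binomialEdgeIdeal K G) V.card) := by
    intro G
    induction G using WellFoundedGT.induction with
    | ind G ihG =>
    intro hG
    by_cases h : ∀ v, completeNeighborhood G v = G
    · rw [componentClosure_eq_self h]
    push Not at h
    obtain ⟨v, hv⟩ := h
    have hlt : G < completeNeighborhood G v := lt_of_le_of_ne (le_completeNeighborhood G v) hv.symm
    obtain ⟨i, hvi⟩ : ∃ i, G.Adj v i := by
      by_contra! h
      exact hv (le_antisymm (fun i j hij => hij.2.elim id fun hi => absurd hi.1 (h i))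
        (le_completeNeighborhood G v))
    have hG' : ∀ i j, (completeNeighborhood G v).Adj i j → i ∈ V := by
      rintro i j ⟨-, hij | hij⟩
      · exact hG _ _ hij
      · exact hG _ _ hij.1.symm
    have hvV := hG _ _ hvi
    have hsub : V.erase v ⊂ V := Finset.erase_ssubset hvV
    -- The bound fails for empty `V`, as `S` has regularity 0, not less than 0; the neighbour `i`
    -- survives.
    have hne : (V.erase v).Nonempty :=
      ⟨i, Finset.mem_erase.2 ⟨hvi.ne', hG _ _ hvi.symm⟩⟩
    rw [← componentClosure_completeNeighborhood G v, ihG _ hlt hG',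
      ← Finset.card_erase_add_one hvV]
    exact regLT_completeNeighborhood_iff
      (ih _ hsub hne _ fun i j hij => Finset.mem_erase.2 ⟨hij.2.1, hG _ _ hij.1⟩)
      (ih _ hsub hne _ fun i j hij => Finset.mem_erase.2 ⟨hij.2.1, hG' _ _ hij.1⟩)
  rw [← hcl G hG]
  -- Colouring by components and sorting by colour makes `listGraph c l` a path forest with the same
  -- components as `G`.
  let c : Fin n → ℕ := fun i => Finite.equivFin _ (G.connectedComponentMk i)
  have hc : ∀ i j, c i = c j ↔ G.Reachable i j := fun i j => by
    simp only [c, Fin.val_inj, EmbeddingLike.apply_eq_iff_eq]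
    exact SimpleGraph.ConnectedComponent.eq
  let l := V.toList.insertionSort (fun i j => c i ≤ c j)
  have hperm : l.Perm V.toList := List.perm_insertionSort _ _
  have hnodup : l.Nodup := hperm.nodup_iff.2 V.nodup_toList
  have hmem : ∀ i, i ∈ l ↔ i ∈ V := fun i => by rw [hperm.mem_iff, Finset.mem_toList]
  have hlen : l.length = V.card := by rw [hperm.length_eq, Finset.length_toList]
  have hsort : l.Pairwise (fun i j => c i ≤ c j) :=
    haveI : Std.Total (fun i j => c i ≤ c j) := ⟨fun i j => le_total _ _⟩
    haveI : IsTrans _ (fun i j => c i ≤ c j) := ⟨fun _ _ _ => le_trans⟩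
    List.pairwise_insertionSort _ _
  have hcl' : componentClosure G = componentClosure (listGraph c l) := by
    ext i j
    refine and_congr_right fun hij => ⟨fun h => ?_, fun h => ?_⟩
    · have key : ∀ {i j}, i ≠ j → G.Reachable i j → i ∈ l := by
        rintro i j hij ⟨w⟩
        cases w with
        | nil => exact absurd rfl hij
        | cons h _ => exact (hmem _).2 (hG _ _ h)
      exact listGraph_reachable hsort (key hij h) (key hij.symm h.symm) ((hc i j).2 h)
    · obtain ⟨w⟩ := h
      clear hij
      induction w with
      | nil => exact SimpleGraph.Reachable.refl _
      | cons h _ ih => exact ((hc _ _).1 (listGraph_adj h).2.2).trans ih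
  rw [hcl', hcl _ fun i j h => (hmem i).1 (listGraph_adj h).1, ← hlen]
  cases h : l with
  | nil =>
    rw [h, List.length_nil] at hlen
    exact absurd hlen.symm (Finset.card_ne_zero.2 hV)
  | cons v l' => exact regLT_listGraph (h ▸ hnodup)

end UpperBound

/-! ### The lower bound from an induced path -/

section LowerBound

variable {K : Type*} [Field K] {n : ℕ}

/-- If `P` is an induced subgraph of `G` together with isolated vertices, then the map
`Tor(S / J_P, K) → Tor(S / J_G, K)` is injective. -/
theorem KoszulVanishes.of_induced {P G : SimpleGraph (Fin n)} (W : Finset (Fin n)) (hPG : P ≤ G)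
    (hP : ∀ i j, P.Adj i j → i ∈ W) (hW : ∀ i j, i ∈ W → j ∈ W → G.Adj i j → P.Adj i j) {i j : ℕ}
    (h : KoszulVanishes ⊤ (binomialEdgeIdeal K G) i j) :
    KoszulVanishes ⊤ (binomialEdgeIdeal K P) i j := by
  intro c hc hDc
  obtain ⟨b, hb, hcb⟩ := h c hc (chainsIn_mono (binomialEdgeIdeal_mono hPG) hDc)
  -- Each variable of a vertex outside `W` is regular modulo `J_P` and the other such variables, so
  -- they can be removed one at a time.
  have descend : ∀ A : Finset (EdgeVar n),
      (∀ t ∈ A, ∃ v, v ∉ W ∧ (t = Sum.inlₗ v ∨ t = Sum.inrₗ v)) →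
      (∃ b ∈ idealBoundaries ⊤ i j, c - b ∈ chainsIn (binomialEdgeIdeal K P ⊔
        Ideal.span ((X : EdgeVar n → MvPolynomial (EdgeVar n) K) '' (A : Set (EdgeVar n))))) →
      ∃ b ∈ idealBoundaries ⊤ i j, c - b ∈ chainsIn (binomialEdgeIdeal K P) := by
    intro A
    induction A using Finset.induction_on with
    | empty => intro _ h; simpa using h
    | insert t A ht ih =>
      intro hA h
      refine ih (fun s hs => hA s (Finset.mem_insert_of_mem hs)) ?_
      rw [Finset.coe_insert, span_X_insert, ← sup_assoc] at h
      refine exists_boundary_of_isRegularMod_X (t := t) ((isGradedIdeal_binomialEdgeIdeal P).sup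
        (isGradedIdeal_span_X _)) (DivXStable.isRegularMod (DivXStable.sup ?_
          (divXStable_span_X (by simpa using ht)))) hc (chainsIn_mono le_sup_left hDc) h
      obtain ⟨v, hv, rfl | rfl⟩ := hA t (Finset.mem_insert_self _ _)
      · exact divXStable_xVar_binomialEdgeIdeal fun w hw => hv (hP _ _ hw)
      · exact divXStable_yVar_binomialEdgeIdeal fun w hw => hv (hP _ _ hw)
  refine descend (Finset.univ.filter fun t => ∃ v, v ∉ W ∧ (t = Sum.inlₗ v ∨ t = Sum.inrₗ v))
    (fun t ht => (Finset.mem_filter.1 ht).2) ⟨b, hb, chainsIn_mono ?_ hcb⟩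
  set A := Ideal.span ((X : EdgeVar n → MvPolynomial (EdgeVar n) K) ''
    ((Finset.univ.filter fun t : EdgeVar n => ∃ v, v ∉ W ∧ (t = Sum.inlₗ v ∨ t = Sum.inrₗ v) :
      Finset (EdgeVar n)) : Set (EdgeVar n))) with hA
  have hvert : ∀ v, v ∉ W → vertexIdeal K v ≤ A := by
    intro v hv
    refine sup_le ?_ ?_ <;> rw [Ideal.span_singleton_le_iff_mem]
    · exact Ideal.subset_span ⟨Sum.inlₗ v, Finset.mem_coe.2
        (Finset.mem_filter.2 ⟨Finset.mem_univ _, v, hv, Or.inl rfl⟩), rfl⟩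
    · exact Ideal.subset_span ⟨Sum.inrₗ v, Finset.mem_coe.2
        (Finset.mem_filter.2 ⟨Finset.mem_univ _, v, hv, Or.inr rfl⟩), rfl⟩
  -- An edge of `G` inside `W` is an edge of `P`; any other has an endpoint whose variables are
  -- killed.
  refine binomialEdgeIdeal_le.2 fun u v huv => ?_
  by_cases hu : u ∈ W
  · by_cases hv : v ∈ W
    · exact Ideal.mem_sup_left (edgeBinomial_mem (hW u v hu hv huv))
    · rw [edgeBinomial_swap]
      exact Ideal.mem_sup_right (neg_mem_iff.2 (hvert v hv (edgeBinomial_mem_vertexIdeal v u)))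
  · exact Ideal.mem_sup_right (hvert u hu (edgeBinomial_mem_vertexIdeal u v))

theorem not_koszulVanishes_of_isIndContained {G : SimpleGraph (Fin n)} {m : ℕ}
    (h : (SimpleGraph.pathGraph (m + 1)).IsIndContained G) :
    ¬KoszulVanishes ⊤ (binomialEdgeIdeal K G) m m := by
  obtain ⟨φ⟩ := h
  have hnodup : (List.ofFn φ).Nodup := List.nodup_ofFn.2 φ.injective
  have hchain : (List.ofFn φ).IsChain G.Adj := by
    rw [List.isChain_iff_getElem]
    intro k hk
    rw [List.getElem_ofFn, List.getElem_ofFn, φ.map_adj_iff, SimpleGraph.pathGraph_adj]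
    exact Or.inl rfl
  have hadj : ∀ a b : Fin (m + 1), a.val + 1 = b.val →
      (listGraph (fun _ => 0) (List.ofFn φ)).Adj (φ a) (φ b) := by
    intro a b hab
    have := listGraph_adj_getElem (c := fun _ => 0) hnodup (k := a) (by simp; omega) rfl
    simp only [List.getElem_ofFn] at this
    convert this using 2
    exact Fin.ext hab.symm
  intro hvan
  have hvan' := hvan.of_induced (P := listGraph (fun _ => 0) (List.ofFn φ))
    (List.ofFn φ).toFinset (listGraph_le hchain)
    (fun i j hij => List.mem_toFinset.2 (listGraph_adj hij).1) (by
      intro i j hi hj hij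
      obtain ⟨a, rfl⟩ := (List.mem_ofFn' _ _).1 (List.mem_toFinset.1 hi)
      obtain ⟨b, rfl⟩ := (List.mem_ofFn' _ _).1 (List.mem_toFinset.1 hj)
      rw [φ.map_adj_iff, SimpleGraph.pathGraph_adj] at hij
      rcases hij with hij | hij
      · exact hadj a b hij
      · exact (hadj b a hij).symm)
  rw [List.ofFn_succ] at hvan' hnodup
  have := not_koszulVanishes_path (K := K) hnodup
  rw [List.length_ofFn] at this
  exact this hvan'

end LowerBound

/-! ### Translation to graded Betti numbers -/

section Betti

variable {K σ : Type*} [Field K] [Fintype σ] [LinearOrder σ]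

theorem mem_koszulChains_idealGrading {I : Ideal (MvPolynomial σ K)} {i j : ℕ}
    {c : Finset σ → I} : c ∈ koszulChains σ (idealGrading I) i (i + j) ↔
      (fun T => (c T : MvPolynomial σ K)) ∈ idealChains I i j := by
  simp only [koszulChains, Submodule.mem_pi, Set.mem_univ, true_imp_iff, mem_idealChains]
  refine forall_congr' fun T => ?_
  by_cases hT : T.card = i
  · rw [if_pos ⟨hT, Nat.le_add_right i j⟩, Nat.add_sub_cancel_left]
    simp [hT, idealGrading]
  · rw [if_neg fun h => hT h.1]
    simp only [Submodule.mem_bot, ne_eq, hT, not_false_iff, true_imp_iff]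
    constructor
    · intro h; simp [h, isHomogeneous_zero]
    · exact fun h => Subtype.ext h.2.2

theorem coe_koszulD {I : Ideal (MvPolynomial σ K)} (c : Finset σ → I) (T : Finset σ) :
    (koszulD K σ I c T : MvPolynomial σ K) =
      koszulD K σ (MvPolynomial σ K) (fun T => (c T : MvPolynomial σ K)) T := by
  simp [koszulD]

theorem gradedBetti_eq_zero_iff {I : Ideal (MvPolynomial σ K)} {i j : ℕ} :
    gradedBetti σ (idealGrading I) i (i + j) = 0 ↔ KoszulVanishes I ⊥ i j := by
  rw [gradedBetti, rank_zero_iff]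
  refine Submodule.Quotient.subsingleton_iff.trans ?_
  rw [Submodule.submoduleOf_eq_top]
  have hbd : ∀ c : Finset σ → I, c ∈ koszulBoundaries σ (idealGrading I) i (i + j) ↔
      (fun T => (c T : MvPolynomial σ K)) ∈ idealBoundaries I i j := by
    intro c
    cases j with
    | zero =>
      -- Chains of homological degree `i + 1` have internal degree at least `i + 1`.
      have h0 : koszulChains σ (idealGrading I) (i + 1) (i + 0) = ⊥ := by
        refine eq_bot_iff.2 fun b hb => ?_
        funext T
        simpa [koszulChains] using hb T trivial
      rw [koszulBoundaries, h0, Submodule.map_bot, idealBoundaries, Submodule.mem_bot,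
        Submodule.mem_bot, funext_iff, funext_iff]
      simp
    | succ j =>
      rw [koszulBoundaries, mem_idealBoundaries_succ, show i + (j + 1) = i + 1 + j by omega]
      constructor
      · rintro ⟨b, hb, rfl⟩
        exact ⟨_, mem_koszulChains_idealGrading.1 hb, funext fun T => (coe_koszulD b T).symm⟩
      · rintro ⟨b, hb, h⟩
        refine ⟨fun T => ⟨b T, (hb T).1⟩, mem_koszulChains_idealGrading.2 hb, ?_⟩
        funext T
        exact Subtype.ext ((coe_koszulD _ T).trans (congrFun h T))
  constructor
  · intro h c hc hDc
    have := (hbd _).1 (h (x := fun T => ⟨c T, (hc T).1⟩)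
      ⟨mem_koszulChains_idealGrading.2 hc, by
        funext T
        exact Subtype.ext ((coe_koszulD _ T).trans (by simpa using mem_chainsIn.1 hDc T))⟩)
    exact ⟨c, this, by simp⟩
  · rintro h c ⟨hc, hDc⟩
    obtain ⟨b, hb, hcb⟩ := h _ (mem_koszulChains_idealGrading.1 hc) (mem_chainsIn.2 fun T => by
      rw [← coe_koszulD, show koszulD K σ I c = 0 from hDc]
      simp)
    rw [hbd]
    convert hb using 1
    funext T
    simpa [sub_eq_zero] using mem_chainsIn.1 hcb T

end Betti

end

/-- For a simple graph `G` on `[n]` with at least one edge, let `ℓ` be the length (number of edges)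
of a longest induced path of `G`.  Then `ℓ + 1 ≤ reg (J_G) ≤ n`. -/
theorem theorem1p1 {K : Type*} [Field K] (n : ℕ) (G : SimpleGraph (Fin n)) (hG : G ≠ ⊥)
    (ℓ : ℕ) (hℓ : IsGreatest {k : ℕ | (SimpleGraph.pathGraph (k + 1)).IsIndContained G} ℓ) :
    ∃ r : ℕ, IsRegularity (EdgeVar n) (idealGrading (binomialEdgeIdeal K G)) r ∧
      ℓ + 1 ≤ r ∧ r ≤ n := by
  obtain ⟨a, b, hab⟩ := SimpleGraph.ne_bot_iff_exists_adj.1 hG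
  have hn : (Finset.univ : Finset (Fin n)).Nonempty := ⟨a, Finset.mem_univ a⟩
  -- A single edge is an induced path of length 1.
  have hℓ1 : 1 ≤ ℓ := by
    refine hℓ.2 ⟨⟨⟨![a, b], ?_⟩, ?_⟩⟩
    · intro i j hij
      fin_cases i <;> fin_cases j <;> simp_all [hab.ne, hab.ne']
    · intro i j
      rw [SimpleGraph.pathGraph_adj]
      fin_cases i <;> fin_cases j <;> simp
      · exact hab
      · exact hab.symm
  set B := {j : ℕ | ∃ i : ℕ,
    gradedBetti (EdgeVar n) (idealGrading (binomialEdgeIdeal K G)) i (i + j) ≠ 0} with hB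
  have hupper : ∀ j ∈ B, j ≤ n := by
    rintro j ⟨i, hij⟩
    by_contra! hj
    obtain ⟨j, rfl⟩ := Nat.exists_eq_add_of_le' (show 1 ≤ j by omega)
    -- `Tor_i(J_G)` in coefficient degree `j + 1` injects into `Tor_{i+1}(S/J_G)` in coefficient
    -- degree `j`, since `S` contributes nothing there.
    refine hij (gradedBetti_eq_zero_iff.2 (KoszulVanishes.left bot_le le_top
      (regLT_top_bot i (j + 1) (by omega)) ?_))
    refine regLT_card Finset.univ hn G (fun i _ _ => Finset.mem_univ i) (i + 1) j ?_
    rw [Finset.card_fin]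
    omega
  have hlower : ℓ + 1 ∈ B := by
    -- With ℓ = k + 1, the nonzero class in `Tor_{k+1}(S/J_G)` of coefficient degree k + 1 comes
    -- from `Tor_k(J_G)` in coefficient degree k + 2 = ℓ + 1.
    obtain ⟨k, rfl⟩ := Nat.exists_eq_add_of_le' hℓ1
    refine ⟨k, fun h => not_koszulVanishes_of_isIndContained (K := K) hℓ.1 ?_⟩
    exact KoszulVanishes.right bot_le le_top (regLT_top_bot (k + 1) (k + 1) (by omega))
      (gradedBetti_eq_zero_iff.1 h)
  obtain ⟨r, hr⟩ := (Set.finite_Iic n |>.subset hupper).exists_maximal ⟨_, hlower⟩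
  have hgr : IsGreatest B r := ⟨hr.1, fun j hj => by
    by_contra! h
    exact absurd (hr.2 hj h.le) (not_le.2 h)⟩
  exact ⟨r, hgr, hgr.2 hlower, hupper r hgr.1⟩
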